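/- Let $d\ge 1$ be an integer and let $p\ge 1$ be real. Let $\mathcal F_d$ be the set of all functions $f:[0,1]^d\to[0,1]$ that are monotonic in each variable, that is, whose restriction to every line segment of $[0,1]^d$ parallel to a coordinate axis is nondecreasing or nonincreasing. Let $\|\cdot\|_p$ be the $L^p$ norm with respect to Lebesgue measure on $[0,1]^d$. For $\varepsilon>0$ let $N(\varepsilon,\mathcal F_d,\|\cdot\|_p)$ be the least $m$ for which there are $f_1,\dots,f_m\in L^p([0,1]^d)$ such that every $f\in\mathcal F_d$ satisfies $\|f-f_k\|_p\le\varepsilon$ for some $k$, and let $N_{[\,]}(\varepsilon,\mathcal F_d,\|\cdot\|_p)$ be the least $m$ for which there are $\underline f_1,\overline f_1,\dots,\underline f_m,\overline f_m\in L^p([0,1]^d)$ with $\|\overline f_k-\underline f_k\|_p\le\varepsilon$ for all $k$ such that every $f\in\mathcal F_d$ satisfies $\underline f_k\le f\le\overline f_k$ pointwise on $[0,1]^d$ for some $k$. Put $\alpha=\max\{d,(d-1)p\}$. Then there are constants $c_1,c_2>0$, depending only on $p$ and $d$, such that for all $0<\varepsilon<1/2$ both numbers are finite and the following holds. If $(d-1)p\ne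 d$, then $$c_1\varepsilon^{-\alpha}\le\log N(\varepsilon,\mathcal F_d,\|\cdot\|_p)\le\log N_{[\,]}(\varepsilon,\mathcal F_d,\|\cdot\|_p)\le c_2\varepsilon^{-\alpha}.$$ If $(d-1)p=d$, then $$c_1\varepsilon^{-d}\le\log N(\varepsilon,\mathcal F_d,\|\cdot\|_p)\le\log N_{[\,]}(\varepsilon,\mathcal F_d,\|\cdot\|_p)\le c_2\varepsilon^{-d}\,(\log 1/\varepsilon)^{1+d/p}.$$ -/

import Mathlib

open MeasureTheory
open scoped ENNReal

/-- The cube `[0,1]^d`, with the product (Lebesgue) measure as `volume`. -/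
abbrev UnitCube (d : ℕ) : Type := Fin d → unitInterval

/-- The functions on `[0,1]^d` with values in `[0,1]` that are monotonic (nondecreasing or
nonincreasing) along every line parallel to a coordinate axis. The line through `x` in direction
`i` is `t ↦ Function.update x i t`. -/
def monotoneClass (d : ℕ) : Set (UnitCube d → ℝ) :=
  {f | (∀ x, 0 ≤ f x ∧ f x ≤ 1) ∧
    ∀ (x : UnitCube d) (i : Fin d),
      Monotone (fun t : unitInterval => f (Function.update x i t)) ∨
        Antitone (fun t : unitInterval => f (Function.update x i t))}

/-- `F` is covered by `m` closed balls of radius `ε` in the `L^p` norm, centred at functions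
in `L^p`. -/
def HasLpCover {d : ℕ} (F : Set (UnitCube d → ℝ)) (p ε : ℝ) (m : ℕ) : Prop :=
  ∃ g : Fin m → UnitCube d → ℝ,
    (∀ k, MemLp (g k) (ENNReal.ofReal p) volume) ∧
    ∀ f ∈ F, ∃ k, eLpNorm (f - g k) (ENNReal.ofReal p) volume ≤ ENNReal.ofReal ε

/-- `F` is covered by `m` brackets `[l k, u k]` of `L^p` size at most `ε`. The order on functions
is the pointwise one, at every point of the cube. -/
def HasLpBracketing {d : ℕ} (F : Set (UnitCube d → ℝ)) (p ε : ℝ) (m : ℕ) : Prop :=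
  ∃ l u : Fin m → UnitCube d → ℝ,
    (∀ k, MemLp (l k) (ENNReal.ofReal p) volume ∧ MemLp (u k) (ENNReal.ofReal p) volume ∧
      eLpNorm (u k - l k) (ENNReal.ofReal p) volume ≤ ENNReal.ofReal ε) ∧
    ∀ f ∈ F, ∃ k, l k ≤ f ∧ f ≤ u k

/-- The covering number `N(ε, F, ‖·‖_p)`; it is `⊤` if there is no finite cover. -/
noncomputable def lpCoveringNumber {d : ℕ} (F : Set (UnitCube d → ℝ)) (p ε : ℝ) : ℕ∞ :=
  ⨅ (m : ℕ) (_ : HasLpCover F p ε m), (m : ℕ∞)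

/-- The bracketing number `N_[](ε, F, ‖·‖_p)`; it is `⊤` if there is no finite bracketing. -/
noncomputable def lpBracketingNumber {d : ℕ} (F : Set (UnitCube d → ℝ)) (p ε : ℝ) : ℕ∞ :=
  ⨅ (m : ℕ) (_ : HasLpBracketing F p ε m), (m : ℕ∞)

/-- The metric entropy `log N(ε, F, ‖·‖_p)`, with `log 0 = ⊥` and `log ⊤ = ⊤`. -/
noncomputable def lpEntropy {d : ℕ} (F : Set (UnitCube d → ℝ)) (p ε : ℝ) : EReal :=
  ENNReal.log (lpCoveringNumber F p ε : ℝ≥0∞)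

/-- The bracketing entropy `log N_[](ε, F, ‖·‖_p)`, with `log 0 = ⊥` and `log ⊤ = ⊤`. -/
noncomputable def lpBracketingEntropy {d : ℕ} (F : Set (UnitCube d → ℝ)) (p ε : ℝ) : EReal :=
  ENNReal.log (lpBracketingNumber F p ε : ℝ≥0∞)

/-!
A coordinatewise monotonic `f : [0,1]^d → [0,1]` has variation at most `1` along each line of a
grid, so over the `2^(kd)` dyadic cells of level `k` its variations add up to at most a constant
times `2^(k(d-1))`. Upper bound: split a cell of level `k` as long as the variation of `f` over it
exceeds a threshold `t k`, and on the resulting leaves record `f` up to the threshold. Few cells are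
split, so the record of `f`, a labelled tree, is short; by Kraft's inequality there are few such
records, and each of them determines a bracket that contains `f`. A geometric choice of the
thresholds balances the size of the brackets against the length of the records.

Lower bound: the functions `x ↦ a (∑ i, c i)` or `b (∑ i, c i)`, where `c` is the index of the cell
of `x`, are monotone for every choice made in each cell as soon as `a j ≤ b j ≤ a (j + 1)`, and a
set of choices that are pairwise close has few elements. A linear staircase `a`, `b` gives the
exponent `d`, a single jump across an antidiagonal of cells the exponent `(d - 1) p`.
-/

/-! ### Dyadic grids -/

/-- The dyadic point `j / 2^k`, truncated to the unit interval. -/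
noncomputable def dyadicPoint (k j : ℕ) : unitInterval :=
  Set.projIcc (0 : ℝ) 1 zero_le_one ((j : ℝ) / 2 ^ k)

/-- The index of the dyadic interval of level `k` that contains `t`; the last interval
is closed on the right. -/
noncomputable def dyadicIndex (k : ℕ) (t : unitInterval) : ℕ :=
  min ⌊(2 : ℝ) ^ k * t⌋₊ (2 ^ k - 1)

lemma dyadicPoint_mono (k : ℕ) : Monotone (dyadicPoint k) := fun _ _ h =>
  Set.monotone_projIcc _ (by gcongr)

lemma coe_dyadicPoint {k j : ℕ} (h : j ≤ 2 ^ k) : (dyadicPoint k j : ℝ) = j / 2 ^ k := by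
  have h' : (j : ℝ) ≤ 2 ^ k := by exact_mod_cast h
  rw [dyadicPoint, Set.projIcc_of_mem]
  exact ⟨by positivity, div_le_one_of_le₀ h' (by positivity)⟩

lemma dyadicPoint_succ_two_mul (k j : ℕ) : dyadicPoint (k + 1) (2 * j) = dyadicPoint k j := by
  unfold dyadicPoint
  congr 1
  push_cast
  rw [pow_succ]
  field_simp

lemma dyadicPoint_succ_sub_dyadicPoint {k j : ℕ} (hj : j < 2 ^ k) :
    (dyadicPoint k (j + 1) : ℝ) - dyadicPoint k j = (2 ^ k)⁻¹ := by
  rw [coe_dyadicPoint hj, coe_dyadicPoint hj.le]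
  push_cast
  field_simp
  ring

lemma dyadicIndex_lt (k : ℕ) (t : unitInterval) : dyadicIndex k t < 2 ^ k := by
  have : 0 < 2 ^ k := by positivity
  unfold dyadicIndex
  omega

lemma dyadicIndex_mono (k : ℕ) : Monotone (dyadicIndex k) := fun a b h => by
  unfold dyadicIndex
  have : (a : ℝ) ≤ b := h
  gcongr

lemma measurable_dyadicIndex (k : ℕ) : Measurable (dyadicIndex k) :=
  (dyadicIndex_mono k).measurable

lemma dyadicIndex_succ_div_two (k : ℕ) (t : unitInterval) :
    dyadicIndex (k + 1) t / 2 = dyadicIndex k t := by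
  unfold dyadicIndex
  have h : ⌊(2 : ℝ) ^ k * t⌋₊ = ⌊(2 : ℝ) ^ (k + 1) * t⌋₊ / 2 := by
    rw [← Nat.floor_div_natCast]
    congr 1
    push_cast
    ring
  have : 0 < 2 ^ k := by positivity
  rw [h, pow_succ]
  omega

lemma dyadicPoint_dyadicIndex_le (k : ℕ) (t : unitInterval) :
    dyadicPoint k (dyadicIndex k t) ≤ t := by
  rw [← Subtype.coe_le_coe, coe_dyadicPoint (dyadicIndex_lt k t).le, div_le_iff₀ (by positivity),
    mul_comm]
  have h : (dyadicIndex k t : ℝ) ≤ ⌊(2 : ℝ) ^ k * t⌋₊ := by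
    rw [Nat.cast_le]
    exact min_le_left _ _
  exact h.trans (Nat.floor_le (mul_nonneg (by positivity) t.2.1))

lemma le_dyadicPoint_dyadicIndex_succ (k : ℕ) (t : unitInterval) :
    t ≤ dyadicPoint k (dyadicIndex k t + 1) := by
  rw [← Subtype.coe_le_coe, coe_dyadicPoint (dyadicIndex_lt k t), le_div_iff₀ (by positivity),
    mul_comm]
  rcases le_total ⌊(2 : ℝ) ^ k * t⌋₊ (2 ^ k - 1) with h | h
  · rw [dyadicIndex, min_eq_left h]
    push_cast
    exact (Nat.lt_floor_add_one _).le
  · rw [dyadicIndex, min_eq_right h, Nat.succ_eq_add_one, Nat.sub_add_cancel Nat.one_le_two_pow]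
    push_cast
    exact mul_le_of_le_one_right (by positivity) t.2.2

lemma dyadicIndex_eq_of_mem_Ico {k j : ℕ} (hj : j < 2 ^ k) {t : unitInterval}
    (ht : t ∈ Set.Ico (dyadicPoint k j) (dyadicPoint k (j + 1))) : dyadicIndex k t = j := by
  obtain ⟨h1, h2⟩ := ht
  rw [← Subtype.coe_le_coe, coe_dyadicPoint hj.le, div_le_iff₀ (by positivity), mul_comm] at h1
  rw [← Subtype.coe_lt_coe, coe_dyadicPoint hj, lt_div_iff₀ (by positivity), mul_comm] at h2
  have : ⌊(2 : ℝ) ^ k * t⌋₊ = j := by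
    rw [Nat.floor_eq_iff (mul_nonneg (by positivity) t.2.1)]
    exact ⟨h1, by exact_mod_cast h2⟩
  rw [dyadicIndex, this]
  omega

lemma volume_dyadicIndex_eq {k j : ℕ} (hj : j < 2 ^ k) :
    volume {t | dyadicIndex k t = j} = ENNReal.ofReal (2 ^ k)⁻¹ := by
  rw [← dyadicPoint_succ_sub_dyadicPoint hj]
  apply le_antisymm
  · rw [← unitInterval.volume_Icc]
    apply measure_mono
    rintro t rfl
    exact ⟨dyadicPoint_dyadicIndex_le k t, le_dyadicPoint_dyadicIndex_succ k t⟩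
  · rw [← unitInterval.volume_Ico]
    exact measure_mono fun t ht => dyadicIndex_eq_of_mem_Ico hj ht

/-- The multi-index of the dyadic cell of level `k` that contains `x`. -/
noncomputable def cellIndex {d : ℕ} (k : ℕ) (x : UnitCube d) : Fin d → ℕ :=
  fun i => dyadicIndex k (x i)

/-- The multi-indices of the dyadic cells of level `k`. -/
def cells (d k : ℕ) : Finset (Fin d → ℕ) := Fintype.piFinset fun _ => Finset.range (2 ^ k)

/-- The vertex `(c + e) / 2^k` of the dyadic grid; for `e : Fin d → Fin 2` these are the corners of
the cell `c`. -/
noncomputable def cellCorner {d : ℕ} (k : ℕ) (c : Fin d → ℕ) (e : Fin d → Fin 2) : UnitCube d :=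
  fun i => dyadicPoint k (c i + e i)

/-- The lower corner of a dyadic cell. -/
noncomputable def lowerCorner {d : ℕ} (k : ℕ) (c : Fin d → ℕ) : UnitCube d :=
  fun i => dyadicPoint k (c i)

/-- The index, one level further down, of the child `e` of the cell with index `c`. -/
def childIndex {d : ℕ} (c : Fin d → ℕ) (e : Fin d → Fin 2) : Fin d → ℕ := fun i => 2 * c i + e i

section Cells

variable {d : ℕ}

lemma cellCorner_zero (k : ℕ) (c : Fin d → ℕ) : cellCorner k c 0 = lowerCorner k c := by
  ext i; simp [cellCorner, lowerCorner]

lemma mem_cells {k : ℕ} {c : Fin d → ℕ} : c ∈ cells d k ↔ ∀ i, c i < 2 ^ k := by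
  simp [cells]

lemma card_cells (d k : ℕ) : (cells d k).card = (2 ^ k) ^ d := by
  simp [cells]

lemma cells_zero (d : ℕ) : cells d 0 = {0} := by
  ext c
  simp [mem_cells, funext_iff]

lemma cellIndex_mem_cells (k : ℕ) (x : UnitCube d) : cellIndex k x ∈ cells d k :=
  mem_cells.2 fun i => dyadicIndex_lt k (x i)

lemma cellIndex_zero (x : UnitCube d) : cellIndex 0 x = 0 := by
  simpa only [cells_zero, Finset.mem_singleton] using cellIndex_mem_cells 0 x

lemma measurable_cellIndex (k : ℕ) : Measurable (cellIndex k : UnitCube d → Fin d → ℕ) :=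
  measurable_pi_lambda _ fun i => (measurable_dyadicIndex k).comp (measurable_pi_apply i)

lemma mem_Icc_cellIndex (k : ℕ) (x : UnitCube d) (i : Fin d) :
    x i ∈ Set.Icc (dyadicPoint k (cellIndex k x i)) (dyadicPoint k (cellIndex k x i + 1)) :=
  ⟨dyadicPoint_dyadicIndex_le k _, le_dyadicPoint_dyadicIndex_succ k _⟩

lemma exists_cellIndex_succ (k : ℕ) (x : UnitCube d) :
    ∃ e, cellIndex (k + 1) x = childIndex (cellIndex k x) e := by
  refine ⟨fun i => ⟨dyadicIndex (k + 1) (x i) % 2, Nat.mod_lt _ two_pos⟩, funext fun i => ?_⟩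
  simp only [cellIndex, childIndex, ← dyadicIndex_succ_div_two k (x i)]
  omega

lemma lowerCorner_childIndex_mem_Icc (k : ℕ) (c : Fin d → ℕ) (e : Fin d → Fin 2) (i : Fin d) :
    lowerCorner (k + 1) (childIndex c e) i ∈
      Set.Icc (dyadicPoint k (c i)) (dyadicPoint k (c i + 1)) := by
  have := (e i).2
  rw [← dyadicPoint_succ_two_mul, ← dyadicPoint_succ_two_mul k (c i + 1)]
  exact ⟨dyadicPoint_mono _ (by simp only [childIndex]; omega),
    dyadicPoint_mono _ (by simp only [childIndex]; omega)⟩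

lemma childIndex_mem_cells {k : ℕ} {c : Fin d → ℕ} (hc : c ∈ cells d k) (e : Fin d → Fin 2) :
    childIndex c e ∈ cells d (k + 1) := by
  rw [mem_cells] at *
  intro i
  have := hc i
  have := (e i).2
  simp only [childIndex, pow_succ]
  omega

lemma childIndex_inj {c c' : Fin d → ℕ} {e e' : Fin d → Fin 2}
    (h : childIndex c e = childIndex c' e') : c = c' ∧ e = e' := by
  have h' : ∀ i, c i = c' i ∧ e i = e' i := fun i => by
    have := congrFun h i
    simp only [childIndex] at this
    exact ⟨by omega, Fin.ext (by omega)⟩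
  exact ⟨funext fun i => (h' i).1, funext fun i => (h' i).2⟩

lemma exists_childIndex_eq {k : ℕ} {c : Fin d → ℕ} (hc : c ∈ cells d (k + 1)) :
    ∃ c' ∈ cells d k, ∃ e, childIndex c' e = c := by
  rw [mem_cells] at hc
  refine ⟨fun i => c i / 2, mem_cells.2 fun i => ?_, fun i => ⟨c i % 2, Nat.mod_lt _ two_pos⟩,
    funext fun i => ?_⟩
  · have := hc i
    rw [pow_succ] at this
    omega
  · simp only [childIndex]
    omega

lemma sum_cells_succ {M : Type*} [AddCommMonoid M] (k : ℕ) (g : (Fin d → ℕ) → M) :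
    ∑ c ∈ cells d k, ∑ e, g (childIndex c e) = ∑ c ∈ cells d (k + 1), g c := by
  rw [← Finset.sum_product']
  refine Finset.sum_bij (fun q _ => childIndex q.1 q.2) ?_ ?_ ?_ fun _ _ => rfl
  · intro q hq
    exact childIndex_mem_cells (Finset.mem_product.1 hq).1 _
  · intro q _ q' _ h
    exact Prod.ext_iff.2 (childIndex_inj h)
  · intro c hc
    obtain ⟨c', hc', e, rfl⟩ := exists_childIndex_eq hc
    exact ⟨(c', e), Finset.mem_product.2 ⟨hc', Finset.mem_univ e⟩, rfl⟩

lemma volume_cellIndex_eq {k : ℕ} {c : Fin d → ℕ} (hc : c ∈ cells d k) :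
    volume {x : UnitCube d | cellIndex k x = c} = ENNReal.ofReal ((2 ^ k)⁻¹ ^ d) := by
  have h : {x : UnitCube d | cellIndex k x = c} =
      Set.univ.pi fun i => {t | dyadicIndex k t = c i} := by
    ext x; simp [cellIndex, funext_iff]
  rw [h, volume_pi_pi, Finset.prod_congr rfl fun i _ => volume_dyadicIndex_eq (mem_cells.1 hc i),
    Finset.prod_const, Finset.card_univ, Fintype.card_fin, ENNReal.ofReal_pow (by positivity)]

lemma lintegral_comp_cellIndex (k : ℕ) (g : (Fin d → ℕ) → ℝ≥0∞) :
    ∫⁻ x : UnitCube d, g (cellIndex k x) =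
      (∑ c ∈ cells d k, g c) * ENNReal.ofReal ((2 ^ k)⁻¹ ^ d) := by
  have hmap : ∀ c, volume.map (cellIndex k : UnitCube d → Fin d → ℕ) {c} =
      volume {x : UnitCube d | cellIndex k x = c} := fun c =>
    Measure.map_apply (measurable_cellIndex k) (measurableSet_singleton c)
  have houtside : ∀ c ∉ cells d k, g c * volume {x : UnitCube d | cellIndex k x = c} = 0 := by
    intro c hc
    have : {x : UnitCube d | cellIndex k x = c} = ∅ :=
      Set.eq_empty_of_forall_notMem fun x hx => hc (hx ▸ cellIndex_mem_cells k x)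
    rw [this, measure_empty, mul_zero]
  rw [← lintegral_map (measurable_of_countable g) (measurable_cellIndex k), lintegral_countable']
  simp_rw [hmap]
  rw [tsum_eq_sum houtside, Finset.sum_mul]
  exact Finset.sum_congr rfl fun c hc => by rw [volume_cellIndex_eq hc]

lemma volume_cellIndex_mem {k : ℕ} {s : Finset (Fin d → ℕ)} (hs : s ⊆ cells d k) :
    volume {x : UnitCube d | cellIndex k x ∈ s} = ENNReal.ofReal (s.card * (2 ^ k)⁻¹ ^ d) := by
  have hmeas : MeasurableSet {x : UnitCube d | cellIndex k x ∈ s} :=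
    measurable_cellIndex k s.measurableSet
  calc volume {x : UnitCube d | cellIndex k x ∈ s}
      = ∫⁻ x : UnitCube d, (s : Set (Fin d → ℕ)).indicator 1 (cellIndex k x) :=
        (lintegral_indicator_one hmeas).symm
    _ = (∑ c ∈ cells d k, (s : Set (Fin d → ℕ)).indicator 1 c) * ENNReal.ofReal ((2 ^ k)⁻¹ ^ d) :=
        lintegral_comp_cellIndex k _
    _ = ENNReal.ofReal (s.card * (2 ^ k)⁻¹ ^ d) := by
        rw [Finset.sum_indicator_subset _ hs, ENNReal.ofReal_mul (by positivity),
          ENNReal.ofReal_natCast]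
        simp

end Cells

/-! ### Variation over a grid -/

lemma sum_abs_sub_succ {f : ℕ → ℝ} (hf : Monotone f ∨ Antitone f) (n : ℕ) :
    ∑ j ∈ Finset.range n, |f (j + 1) - f j| = |f n - f 0| := by
  rcases hf with hf | hf
  · rw [abs_of_nonneg (sub_nonneg.2 (hf n.zero_le)), ← Finset.sum_range_sub]
    exact Finset.sum_congr rfl fun j _ => abs_of_nonneg (sub_nonneg.2 (hf j.le_succ))
  · rw [abs_of_nonpos (sub_nonpos.2 (hf n.zero_le)), neg_sub, ← Finset.sum_range_sub']
    exact Finset.sum_congr rfl fun j _ => by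
      rw [abs_of_nonpos (sub_nonpos.2 (hf j.le_succ)), neg_sub]

/-- The total variation of `f` along the edges in direction `i` of a dyadic cell (each edge is
counted twice). -/
noncomputable def edgeVariation {d : ℕ} (f : UnitCube d → ℝ) (k : ℕ) (c : Fin d → ℕ) (i : Fin d) :
    ℝ :=
  ∑ e : Fin d → Fin 2, |f (cellCorner k c (Function.update e i 1)) -
    f (cellCorner k c (Function.update e i 0))|

/-- The total variation of `f` along the edges of a dyadic cell (each edge is counted twice). -/
noncomputable def cellVariation {d : ℕ} (f : UnitCube d → ℝ) (k : ℕ) (c : Fin d → ℕ) : ℝ :=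
  ∑ i, edgeVariation f k c i

section Variation

variable {d : ℕ}

lemma cellVariation_nonneg (f : UnitCube d → ℝ) (k : ℕ) (c : Fin d → ℕ) :
    0 ≤ cellVariation f k c :=
  Finset.sum_nonneg fun _ _ => Finset.sum_nonneg fun _ _ => abs_nonneg _

lemma abs_edge_le_edgeVariation (f : UnitCube d → ℝ) (k : ℕ) (c : Fin d → ℕ) (i : Fin d)
    (e : Fin d → Fin 2) :
    |f (cellCorner k c (Function.update e i 1)) - f (cellCorner k c (Function.update e i 0))| ≤
      edgeVariation f k c i :=
  Finset.single_le_sum (f := fun e : Fin d → Fin 2 =>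
    |f (cellCorner k c (Function.update e i 1)) - f (cellCorner k c (Function.update e i 0))|)
    (fun _ _ => abs_nonneg _) (Finset.mem_univ e)

lemma cellCorner_update (k : ℕ) (c : Fin d → ℕ) (e : Fin d → Fin 2) (i : Fin d) (r : Fin 2) :
    cellCorner k c (Function.update e i r) =
      Function.update (cellCorner k c e) i (dyadicPoint k (c i + r)) := by
  funext j
  rcases eq_or_ne j i with rfl | h
  · simp [cellCorner]
  · simp [cellCorner, h]

lemma cellCorner_update_update (k : ℕ) (c : Fin d → ℕ) (e : Fin d → Fin 2) (i : Fin d) (j : ℕ)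
    (r : Fin 2) : cellCorner k (Function.update c i j) (Function.update e i r) =
      Function.update (cellCorner k c e) i (dyadicPoint k (j + r)) := by
  rw [cellCorner_update]
  funext l
  rcases eq_or_ne l i with rfl | hl
  · simp
  · simp [hl, cellCorner]

lemma mem_uIcc_update {f : UnitCube d → ℝ} (hf : f ∈ monotoneClass d) {x : UnitCube d} {i : Fin d}
    {a b : unitInterval} (hx : x i ∈ Set.Icc a b) :
    f x ∈ Set.uIcc (f (Function.update x i a)) (f (Function.update x i b)) := by
  rw [Set.mem_uIcc]
  rcases hf.2 x i with hm | hm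
  · left
    simpa only [Function.update_eq_self] using And.intro (hm hx.1) (hm hx.2)
  · right
    simpa only [Function.update_eq_self] using And.intro (hm hx.2) (hm hx.1)

lemma abs_sub_cellCorner_le {f : UnitCube d → ℝ} (hf : f ∈ monotoneClass d) (k : ℕ)
    (c : Fin d → ℕ) (S : Finset (Fin d)) : ∀ (e : Fin d → Fin 2) (x : UnitCube d),
      (∀ i ∈ S, x i ∈ Set.Icc (dyadicPoint k (c i)) (dyadicPoint k (c i + 1))) →
      (∀ i ∉ S, x i = cellCorner k c e i) →
      |f x - f (cellCorner k c e)| ≤ ∑ i ∈ S, edgeVariation f k c i := by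
  induction S using Finset.induction_on with
  | empty =>
    intro e x _ hx
    have : x = cellCorner k c e := funext fun i => hx i (Finset.notMem_empty i)
    simp [this]
  | insert i S hi ih =>
    intro e x hS hx
    rw [Finset.sum_insert hi]
    have hface : ∀ r : Fin 2, |f (Function.update x i (dyadicPoint k (c i + r))) -
        f (cellCorner k c (Function.update e i r))| ≤ ∑ i ∈ S, edgeVariation f k c i := by
      refine fun r => ih _ _ (fun j hj => ?_) fun j hj => ?_
      · rw [Function.update_of_ne (ne_of_mem_of_not_mem hj hi)]
        exact hS j (Finset.mem_insert_of_mem hj)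
      · rw [cellCorner_update]
        rcases eq_or_ne j i with rfl | hji
        · simp
        · rw [Function.update_of_ne hji, Function.update_of_ne hji]
          exact hx j (by simp [hj, hji])
    have hlower := hface 0
    have hupper := hface 1
    have hedge := abs_edge_le_edgeVariation f k c i e
    have hend : f (cellCorner k c e) = f (cellCorner k c (Function.update e i 0)) ∨
        f (cellCorner k c e) = f (cellCorner k c (Function.update e i 1)) := by
      have : e i = 0 ∨ e i = 1 := by omega
      refine this.imp (fun h => ?_) fun h => ?_ <;> rw [← h, Function.update_eq_self]
    have hbetween := Set.mem_uIcc.1 (mem_uIcc_update hf (hS i (Finset.mem_insert_self i S)))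
    simp only [Fin.val_zero, Fin.val_one, add_zero] at hlower hupper
    rw [abs_le] at hlower hupper hedge ⊢
    rcases hend with h | h <;> rw [h] <;> rcases hbetween with hb | hb <;> constructor <;> linarith

lemma abs_sub_lowerCorner_le {f : UnitCube d → ℝ} (hf : f ∈ monotoneClass d) {k : ℕ}
    {c : Fin d → ℕ} {x : UnitCube d}
    (hx : ∀ i, x i ∈ Set.Icc (dyadicPoint k (c i)) (dyadicPoint k (c i + 1))) :
    |f x - f (lowerCorner k c)| ≤ cellVariation f k c := by
  rw [← cellCorner_zero]
  exact abs_sub_cellCorner_le hf k c Finset.univ 0 x (fun i _ => hx i)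
    (fun i hi => absurd (Finset.mem_univ i) hi)

lemma sum_abs_sub_update_le_one {f : UnitCube d → ℝ} (hf : f ∈ monotoneClass d) (x : UnitCube d)
    (i : Fin d) {y : ℕ → unitInterval} (hy : Monotone y) (n : ℕ) :
    ∑ j ∈ Finset.range n, |f (Function.update x i (y (j + 1))) - f (Function.update x i (y j))|
      ≤ 1 := by
  have hline := (hf.2 x i).imp (fun h => h.comp hy) fun h => h.comp_monotone hy
  exact (sum_abs_sub_succ hline n).trans_le
    (abs_sub_le_of_nonneg_of_le (hf.1 _).1 (hf.1 _).2 (hf.1 _).1 (hf.1 _).2)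

lemma sum_cells_update (k : ℕ) (i : Fin d) (g : (Fin d → ℕ) → ℝ) :
    ∑ c ∈ cells d k, ∑ j ∈ Finset.range (2 ^ k), g (Function.update c i j) =
      2 ^ k * ∑ c ∈ cells d k, g c := by
  have hmem : ∀ q ∈ cells d k ×ˢ Finset.range (2 ^ k),
      (Function.update q.1 i q.2, q.1 i) ∈ cells d k ×ˢ Finset.range (2 ^ k) := by
    intro q hq
    simp only [Finset.mem_product, mem_cells, Finset.mem_range] at hq ⊢
    refine ⟨fun j => ?_, hq.1 i⟩
    rcases eq_or_ne j i with rfl | hj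
    · simpa using hq.2
    · simpa [hj] using hq.1 j
  have hswap : ∑ q ∈ cells d k ×ˢ Finset.range (2 ^ k), g (Function.update q.1 i q.2) =
      ∑ q ∈ cells d k ×ˢ Finset.range (2 ^ k), g q.1 := by
    refine Finset.sum_nbij' (fun q => (Function.update q.1 i q.2, q.1 i))
      (fun q => (Function.update q.1 i q.2, q.1 i)) hmem hmem ?_ ?_ ?_ <;> simp
  rw [← Finset.sum_product' (f := fun c j => g (Function.update c i j)), hswap,
    Finset.sum_product' (f := fun c _ => g c), Finset.mul_sum]
  simp

lemma sum_cells_edge_le {f : UnitCube d → ℝ} (hf : f ∈ monotoneClass d) (k : ℕ) (i : Fin d)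
    (e : Fin d → Fin 2) : ∑ c ∈ cells d k, |f (cellCorner k c (Function.update e i 1)) -
      f (cellCorner k c (Function.update e i 0))| ≤ ((2 : ℝ) ^ k) ^ (d - 1) := by
  have hk : (0 : ℝ) < 2 ^ k := by positivity
  rw [← mul_le_mul_iff_right₀ hk, ← sum_cells_update k i, ← pow_succ', Nat.sub_add_cancel i.pos]
  have hline : ∀ c ∈ cells d k, ∑ j ∈ Finset.range (2 ^ k),
      |f (cellCorner k (Function.update c i j) (Function.update e i 1)) -
        f (cellCorner k (Function.update c i j) (Function.update e i 0))| ≤ 1 := by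
    intro c _
    simp only [cellCorner_update_update, Fin.val_one, Fin.val_zero, add_zero]
    exact sum_abs_sub_update_le_one hf _ i (dyadicPoint_mono k) _
  calc _ ≤ ((cells d k).card : ℝ) := by
        simpa only [Finset.sum_const, nsmul_one] using Finset.sum_le_sum hline
    _ = _ := by rw [card_cells]; push_cast; rfl

lemma sum_cellVariation_le {f : UnitCube d → ℝ} (hf : f ∈ monotoneClass d) (k : ℕ) :
    ∑ c ∈ cells d k, cellVariation f k c ≤ d * 2 ^ d * ((2 : ℝ) ^ k) ^ (d - 1) := by
  have hdir : ∀ i, ∑ c ∈ cells d k, edgeVariation f k c i ≤ 2 ^ d * ((2 : ℝ) ^ k) ^ (d - 1) := by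
    intro i
    unfold edgeVariation
    rw [Finset.sum_comm]
    refine (Finset.sum_le_sum fun e _ => sum_cells_edge_le hf k i e).trans_eq ?_
    simp
  unfold cellVariation
  rw [Finset.sum_comm]
  refine (Finset.sum_le_sum fun i _ => hdir i).trans_eq ?_
  simp [mul_assoc]

end Variation

/-! ### Labelled trees -/

lemma tsum_option_ennreal {X : Type*} (w : Option X → ℝ≥0∞) :
    ∑' o, w o = w none + ∑' x, w (some x) := by
  classical
  rw [ENNReal.summable.tsum_eq_add_tsum_ite' none, ← (Option.some_injective X).tsum_eq]
  · simp
  · rintro (_ | x) h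
    · simp at h
    · exact ⟨x, rfl⟩

lemma tsum_prod_le_prod_tsum {E X : Type*} [Fintype E] (w : X → ℝ≥0∞) :
    ∑' φ : E → X, ∏ e, w (φ e) ≤ ∏ _e : E, ∑' x, w x := by
  classical
  rw [ENNReal.tsum_eq_iSup_sum]
  refine iSup_le fun s => ?_
  calc ∑ φ ∈ s, ∏ e, w (φ e)
      ≤ ∑ φ ∈ Fintype.piFinset fun e => s.image fun φ => φ e, ∏ e, w (φ e) :=
        Finset.sum_le_sum_of_subset fun φ hφ =>
          Fintype.mem_piFinset.2 fun e => Finset.mem_image_of_mem _ hφ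
    _ = ∏ e, ∑ x ∈ s.image fun φ => φ e, w x := (Finset.prod_univ_sum _ _).symm
    _ ≤ ∏ _e : E, ∑' x, w x := Finset.prod_le_prod' fun e _ => ENNReal.sum_le_tsum _

lemma tsum_two_inv_pow_natAbs_le : ∑' a : ℤ, (2⁻¹ : ℝ≥0∞) ^ (3 + a.natAbs) ≤ 2⁻¹ := by
  have hnat : ∑' n : ℕ, (2⁻¹ : ℝ≥0∞) ^ (n : ℤ).natAbs = 2 := by
    simp_rw [Int.natAbs_natCast, ENNReal.tsum_geometric_two]
  have hneg : ∑' n : ℕ, (2⁻¹ : ℝ≥0∞) ^ (-((n : ℤ) + 1)).natAbs = 1 := by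
    have h : ∀ n : ℕ, (-((n : ℤ) + 1)).natAbs = n + 1 := fun n => by omega
    simp_rw [h, pow_succ, ENNReal.tsum_mul_right, ENNReal.tsum_geometric_two]
    exact ENNReal.mul_inv_cancel two_ne_zero ENNReal.ofNat_ne_top
  simp_rw [pow_add, ENNReal.tsum_mul_left]
  rw [tsum_of_nat_of_neg_add_one ENNReal.summable ENNReal.summable, hnat, hneg]
  calc (2⁻¹ : ℝ≥0∞) ^ 3 * (2 + 1) ≤ 2⁻¹ ^ 3 * (2 * 2) := by
        gcongr
        norm_num
    _ = 2⁻¹ * (2⁻¹ * 2) * (2⁻¹ * 2) := by ring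
    _ = 2⁻¹ := by
        rw [ENNReal.inv_mul_cancel two_ne_zero ENNReal.ofNat_ne_top, mul_one, mul_one]

/-- Trees of depth at most `h`, with branches indexed by `E` and nodes labelled by integers. -/
def LabelledTree (E : Type) : ℕ → Type
  | 0 => ℤ
  | h + 1 => ℤ × Option (E → LabelledTree E h)

namespace LabelledTree

variable {E : Type} [Fintype E]

/-- The cost of a labelled tree is the sum of `3 + |a|` over the labels `a` of its nodes. It bounds
the length of a binary encoding of the tree. -/
def cost : (h : ℕ) → LabelledTree E h → ℕ
  | 0, a => 3 + Int.natAbs a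
  | _ + 1, (a, none) => 3 + Int.natAbs a
  | h + 1, (a, some φ) => 3 + Int.natAbs a + ∑ e, cost h (φ e)

/-- Kraft's inequality: each label contributes at most `1/2`, each choice between a leaf and a
branching at most `1 + 1`. -/
lemma tsum_two_inv_pow_cost_le_one : ∀ h, ∑' T : LabelledTree E h, (2⁻¹ : ℝ≥0∞) ^ cost h T ≤ 1
  | 0 => tsum_two_inv_pow_natAbs_le.trans (by simp)
  | h + 1 => by
    let w : Option (E → LabelledTree E h) → ℝ≥0∞
      | none => 1
      | some φ => ∏ e, 2⁻¹ ^ cost h (φ e)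
    have hcost : ∀ a o, (2⁻¹ : ℝ≥0∞) ^ cost (h + 1) (a, o) = 2⁻¹ ^ (3 + Int.natAbs a) * w o := by
      rintro a (_ | φ)
      · simp only [cost, w, mul_one]
      · simp only [cost, w, pow_add, Finset.prod_pow_eq_pow_sum]
    have hbranch : ∑' o, w o ≤ 2 := by
      rw [tsum_option_ennreal, ← one_add_one_eq_two]
      gcongr
      exact (tsum_prod_le_prod_tsum _).trans
        (Finset.prod_le_one' fun _ _ => tsum_two_inv_pow_cost_le_one h)
    calc ∑' T : ℤ × Option (E → LabelledTree E h), (2⁻¹ : ℝ≥0∞) ^ cost (h + 1) T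
        = (∑' a : ℤ, 2⁻¹ ^ (3 + a.natAbs)) * ∑' o, w o := by
          rw [ENNReal.tsum_prod']
          simp_rw [hcost, ENNReal.tsum_mul_left, ENNReal.tsum_mul_right]
      _ ≤ 2⁻¹ * 2 := mul_le_mul' tsum_two_inv_pow_natAbs_le hbranch
      _ = 1 := ENNReal.inv_mul_cancel two_ne_zero ENNReal.ofNat_ne_top

lemma exists_finite_card_cost_le (h N : ℕ) :
    ∃ hfin : {T : LabelledTree E h | cost h T ≤ N}.Finite, hfin.toFinset.card ≤ 2 ^ N := by
  obtain ⟨hfin, hcard⟩ := ENNReal.finset_card_const_le_le_of_tsum_le ENNReal.one_ne_top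
    (tsum_two_inv_pow_cost_le_one (E := E) h) (ε := 2⁻¹ ^ N) (by simp)
  have hsub : {T : LabelledTree E h | cost h T ≤ N} ⊆ {T | 2⁻¹ ^ N ≤ (2⁻¹ : ℝ≥0∞) ^ cost h T} :=
    fun T hT => pow_le_pow_right_of_le_one' (ENNReal.inv_le_one.2 one_le_two) hT
  have hcard' : hfin.toFinset.card ≤ 2 ^ N := by
    rw [one_div, ENNReal.inv_pow, inv_inv] at hcard
    exact_mod_cast hcard
  exact ⟨hfin.subset hsub,
    (Finset.card_le_card (Set.Finite.toFinset_subset_toFinset.2 hsub)).trans hcard'⟩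

end LabelledTree

/-! ### Adaptive dyadic partitions -/

/-- A dyadic cell `c` of level `k` is subdivided by the adaptive partition if `k < n` or if the
variation of `f` over it exceeds the threshold `t k`. -/
def NeedsSplit {d : ℕ} (n : ℕ) (t : ℕ → ℝ) (f : UnitCube d → ℝ) (k : ℕ) (c : Fin d → ℕ) : Prop :=
  k < n ∨ t k < cellVariation f k c

/-- The value of `f` at the lower corner of a cell, rounded down to a multiple of `t k` and divided
by it. -/
noncomputable def roundedValue {d : ℕ} (t : ℕ → ℝ) (f : UnitCube d → ℝ) (k : ℕ) (c : Fin d → ℕ) :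
    ℤ :=
  ⌊f (lowerCorner k c) / t k⌋

/-- The prediction, from the rounded value of a cell of level `k`, of the rounded values of its
children. -/
noncomputable def predictedValue {d : ℕ} (t : ℕ → ℝ) (f : UnitCube d → ℝ) (k : ℕ) (c : Fin d → ℕ) :
    ℤ :=
  ⌊(roundedValue t f k c : ℝ) * (t k / t (k + 1))⌋

open Classical in
/-- The tree that encodes the adaptive partition of the cell `c` of level `k`, with at most `h`
generations of subdivisions, and the rounded values of `f`, each one relative to its prediction;
`b` is the prediction for the cell `c` itself. -/
noncomputable def encode {d : ℕ} (n : ℕ) (t : ℕ → ℝ) (f : UnitCube d → ℝ) :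
    (h k : ℕ) → (Fin d → ℕ) → ℤ → LabelledTree (Fin d → Fin 2) h
  | 0, k, c, b => (roundedValue t f k c - b : ℤ)
  | h + 1, k, c, b => (roundedValue t f k c - b,
      if NeedsSplit n t f k c then
        some fun e => encode n t f h (k + 1) (childIndex c e) (predictedValue t f k c)
      else none)

/-- The code of `f`: the encoding of the adaptive partition of the whole cube, down to level `K`. -/
noncomputable def code {d : ℕ} (n : ℕ) (t : ℕ → ℝ) (K : ℕ) (f : UnitCube d → ℝ) :
    LabelledTree (Fin d → Fin 2) K :=
  encode n t f K 0 0 0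

open Classical in
/-- The level of the cell of the adaptive partition that contains `x`, where the partition starts
from level `k` and makes at most `h` generations of subdivisions. -/
noncomputable def leafLevel {d : ℕ} (n : ℕ) (t : ℕ → ℝ) (f : UnitCube d → ℝ) (x : UnitCube d) :
    (h k : ℕ) → ℕ
  | 0, k => k
  | h + 1, k => if NeedsSplit n t f k (cellIndex k x) then leafLevel n t f x h (k + 1) else k

section Leaf

variable {d : ℕ} {n : ℕ} {t : ℕ → ℝ} {f g : UnitCube d → ℝ}

lemma leafLevel_le (x : UnitCube d) : ∀ h k, leafLevel n t f x h k ≤ k + h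
  | 0, _ => le_rfl
  | h + 1, k => by
    unfold leafLevel
    split_ifs
    · exact (leafLevel_le x h (k + 1)).trans (by omega)
    · omega

lemma leafLevel_eq_or_not_needsSplit (x : UnitCube d) : ∀ h k, leafLevel n t f x h k = k + h ∨
    ¬ NeedsSplit n t f (leafLevel n t f x h k) (cellIndex (leafLevel n t f x h k) x)
  | 0, _ => Or.inl rfl
  | h + 1, k => by
    by_cases hk : NeedsSplit n t f k (cellIndex k x)
    · simp only [leafLevel, if_pos hk]
      exact (leafLevel_eq_or_not_needsSplit x h (k + 1)).imp_left fun h' => by omega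
    · simp only [leafLevel, if_neg hk]
      exact Or.inr hk

lemma needsSplit_of_lt_leafLevel (x : UnitCube d) : ∀ h k j, k ≤ j → j < leafLevel n t f x h k →
    NeedsSplit n t f j (cellIndex j x)
  | 0, _, _, hkj, hj => absurd hj (not_lt.2 hkj)
  | h + 1, k, j, hkj, hj => by
    by_cases hk : NeedsSplit n t f k (cellIndex k x)
    · simp only [leafLevel, if_pos hk] at hj
      rcases hkj.eq_or_lt with rfl | hlt
      · exact hk
      · exact needsSplit_of_lt_leafLevel x h (k + 1) j hlt hj
    · simp only [leafLevel, if_neg hk] at hj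
      exact absurd hj (not_lt.2 hkj)

lemma le_leafLevel_root (x : UnitCube d) {K : ℕ} (hK : n ≤ K) : n ≤ leafLevel n t f x K 0 := by
  by_contra! hlt
  rcases leafLevel_eq_or_not_needsSplit (n := n) (t := t) (f := f) x K 0 with h | h
  · omega
  · exact h (Or.inl hlt)

lemma measurable_leafLevel : ∀ h k, Measurable fun x : UnitCube d => leafLevel n t f x h k
  | 0, _ => measurable_const
  | h + 1, k => by
    unfold leafLevel
    refine Measurable.ite ?_ (measurable_leafLevel h (k + 1)) measurable_const
    exact measurable_cellIndex k
      (MeasurableSet.of_discrete (s := {c : Fin d → ℕ | NeedsSplit n t f k c}))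

lemma leafLevel_eq_of_encode_eq (x : UnitCube d) : ∀ (h k : ℕ) (b : ℤ),
    encode n t f h k (cellIndex k x) b = encode n t g h k (cellIndex k x) b →
    leafLevel n t f x h k = leafLevel n t g x h k ∧
      roundedValue t f (leafLevel n t g x h k) (cellIndex (leafLevel n t g x h k) x) =
        roundedValue t g (leafLevel n t g x h k) (cellIndex (leafLevel n t g x h k) x)
  | 0, _, b, hfg => ⟨rfl, sub_left_injective (b := b) hfg⟩
  | h + 1, k, b, hfg => by
    obtain ⟨hvalue, hsplit⟩ := Prod.ext_iff.1 hfg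
    have hround : roundedValue t f k (cellIndex k x) = roundedValue t g k (cellIndex k x) :=
      sub_left_injective (b := b) hvalue
    simp only [encode, predictedValue, hround] at hsplit
    by_cases hf : NeedsSplit n t f k (cellIndex k x) <;>
      by_cases hg : NeedsSplit n t g k (cellIndex k x)
    · rw [if_pos hf, if_pos hg, Option.some.injEq] at hsplit
      obtain ⟨e, he⟩ := exists_cellIndex_succ k x
      have hchild := congrFun hsplit e
      rw [← he] at hchild
      simp only [leafLevel, if_pos hf, if_pos hg]
      exact leafLevel_eq_of_encode_eq x h (k + 1) _ hchild
    · simp [hf, hg] at hsplit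
    · simp [hf, hg] at hsplit
    · simp only [leafLevel, if_neg hf, if_neg hg]
      exact ⟨trivial, hround⟩

lemma leafLevel_eq_of_code_eq {K : ℕ} (hfg : code n t K f = code n t K g) (x : UnitCube d) :
    leafLevel n t f x K 0 = leafLevel n t g x K 0 ∧
      roundedValue t f (leafLevel n t g x K 0) (cellIndex (leafLevel n t g x K 0) x) =
        roundedValue t g (leafLevel n t g x K 0) (cellIndex (leafLevel n t g x K 0) x) := by
  refine leafLevel_eq_of_encode_eq x K 0 0 ?_
  rw [cellIndex_zero]
  exact hfg

lemma abs_sub_leaf_le (hf : f ∈ monotoneClass d) {K : ℕ} (htK : 1 ≤ t K) (x : UnitCube d) :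
    |f x - f (lowerCorner (leafLevel n t f x K 0) (cellIndex (leafLevel n t f x K 0) x))| ≤
      t (leafLevel n t f x K 0) := by
  rcases leafLevel_eq_or_not_needsSplit (n := n) (t := t) (f := f) x K 0 with h | h
  · rw [h, zero_add]
    exact (abs_sub_le_of_nonneg_of_le (hf.1 _).1 (hf.1 _).2 (hf.1 _).1 (hf.1 _).2).trans htK
  · simp only [NeedsSplit, not_or, not_lt] at h
    exact (abs_sub_lowerCorner_le hf fun i => mem_Icc_cellIndex _ x i).trans h.2

end Leaf

/-! ### The cost of the code -/

lemma abs_floor_sub_floor_floor_mul_le {x y r δ : ℝ} (hr : 0 ≤ r) (hr2 : r ≤ 2)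
    (h : |y - x * r| ≤ δ) : |(⌊y⌋ : ℝ) - ⌊(⌊x⌋ : ℝ) * r⌋| ≤ 4 + δ := by
  have hlower : (⌊x⌋ : ℝ) * r ≤ x * r := mul_le_mul_of_nonneg_right (Int.floor_le x) hr
  have hupper : x * r ≤ (⌊x⌋ : ℝ) * r + 2 := by
    nlinarith [mul_le_mul_of_nonneg_right (Int.lt_floor_add_one x).le hr]
  have hy := Int.floor_le y
  have hy' := Int.lt_floor_add_one y
  have hz := Int.floor_le ((⌊x⌋ : ℝ) * r)
  have hz' := Int.lt_floor_add_one ((⌊x⌋ : ℝ) * r)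
  rw [abs_le] at h ⊢
  constructor <;> linarith [h.1, h.2]

/-- A bound for the cost of the labels of the children of a cell that is subdivided. -/
noncomputable def splitCost {d : ℕ} (n : ℕ) (t : ℕ → ℝ) (f : UnitCube d → ℝ) (k : ℕ)
    (c : Fin d → ℕ) : ℝ :=
  2 ^ d * ((if k < n then 7 else 0) + 9 * (cellVariation f k c / t k))

/-- The sum of the split costs over all descendants of a cell, down to `h` generations. -/
noncomputable def totalSplitCost {d : ℕ} (n : ℕ) (t : ℕ → ℝ) (f : UnitCube d → ℝ) :
    (h k : ℕ) → (Fin d → ℕ) → ℝ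
  | 0, _, _ => 0
  | h + 1, k, c => splitCost n t f k c + ∑ e, totalSplitCost n t f h (k + 1) (childIndex c e)

/-- The bound for the cost of the codes of functions on `[0,1]^d`, for the partitions that end at
level `K`. -/
noncomputable def costBound (d n : ℕ) (t : ℕ → ℝ) (K : ℕ) : ℝ :=
  4 + ∑ k ∈ Finset.range K, 2 ^ d * ((if k < n then 7 * ((2 : ℝ) ^ k) ^ d else 0) +
    9 * (d * 2 ^ d * ((2 : ℝ) ^ k) ^ (d - 1) / t k))

section Cost

variable {d : ℕ} {n : ℕ} {t : ℕ → ℝ} {f : UnitCube d → ℝ}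

lemma natAbs_roundedValue_sub_predictedValue_le (hf : f ∈ monotoneClass d) {k : ℕ} (ht : 0 < t k)
    (ht' : t k ≤ 2 * t (k + 1)) (c : Fin d → ℕ) (e : Fin d → Fin 2) :
    ((roundedValue t f (k + 1) (childIndex c e) - predictedValue t f k c).natAbs : ℝ) ≤
      4 + 2 * (cellVariation f k c / t k) := by
  have ht1 : 0 < t (k + 1) := by linarith
  have hratio : t k / t (k + 1) ≤ 2 := by rwa [div_le_iff₀ ht1]
  have hV := abs_sub_lowerCorner_le hf (x := lowerCorner (k + 1) (childIndex c e))
    (lowerCorner_childIndex_mem_Icc k c e)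
  rw [Nat.cast_natAbs, Int.cast_abs, Int.cast_sub]
  refine abs_floor_sub_floor_floor_mul_le (div_pos ht ht1).le hratio ?_
  calc |f (lowerCorner (k + 1) (childIndex c e)) / t (k + 1) -
        f (lowerCorner k c) / t k * (t k / t (k + 1))|
      = |f (lowerCorner (k + 1) (childIndex c e)) - f (lowerCorner k c)| / t (k + 1) := by
        rw [div_mul_div_cancel₀ ht.ne', ← sub_div, abs_div, abs_of_pos ht1]
    _ ≤ cellVariation f k c / t (k + 1) := by gcongr
    _ = t k / t (k + 1) * (cellVariation f k c / t k) := by field_simp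
    _ ≤ 2 * (cellVariation f k c / t k) := by
        gcongr
        exact div_nonneg (cellVariation_nonneg f k c) ht.le

lemma splitCost_nonneg (ht : ∀ k, 0 < t k) (k : ℕ) (c : Fin d → ℕ) : 0 ≤ splitCost n t f k c := by
  have := cellVariation_nonneg f k c
  have := ht k
  unfold splitCost
  positivity

lemma totalSplitCost_nonneg (ht : ∀ k, 0 < t k) : ∀ (h k : ℕ) (c : Fin d → ℕ),
    0 ≤ totalSplitCost n t f h k c
  | 0, _, _ => le_rfl
  | h + 1, k, c => add_nonneg (splitCost_nonneg ht k c)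
      (Finset.sum_nonneg fun _ _ => totalSplitCost_nonneg ht h _ _)

lemma sum_totalSplitCost : ∀ h k : ℕ, ∑ c ∈ cells d k, totalSplitCost n t f h k c =
    ∑ j ∈ Finset.range h, ∑ c ∈ cells d (k + j), splitCost n t f (k + j) c
  | 0, k => by simp [totalSplitCost]
  | h + 1, k => by
    simp only [totalSplitCost]
    rw [Finset.sum_add_distrib, sum_cells_succ, sum_totalSplitCost h (k + 1),
      Finset.sum_range_succ', add_comm]
    simp only [add_zero, add_right_comm k 1, add_assoc]

lemma children_label_cost_le {k : ℕ} (ht : 0 < t k) {c : Fin d → ℕ} (hc : NeedsSplit n t f k c) :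
    2 ^ d * (7 + 2 * (cellVariation f k c / t k)) ≤ splitCost n t f k c := by
  have h0 : 0 ≤ cellVariation f k c / t k := div_nonneg (cellVariation_nonneg f k c) ht.le
  unfold splitCost
  refine mul_le_mul_of_nonneg_left ?_ (by positivity)
  by_cases hk : k < n
  · rw [if_pos hk]
    linarith
  · have : 1 < cellVariation f k c / t k := (one_lt_div ht).2 (hc.resolve_left hk)
    rw [if_neg hk]
    linarith

lemma cost_encode_le (hf : f ∈ monotoneClass d) (ht : ∀ k, 0 < t k)
    (ht' : ∀ k, t k ≤ 2 * t (k + 1)) : ∀ (h k : ℕ) (c : Fin d → ℕ) (b : ℤ),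
    ((encode n t f h k c b).cost : ℝ) ≤
      3 + (roundedValue t f k c - b).natAbs + totalSplitCost n t f h k c
  | 0, k, c, b => by
    simp only [encode, LabelledTree.cost, totalSplitCost, add_zero, Nat.cast_add, Nat.cast_ofNat]
    exact le_rfl
  | h + 1, k, c, b => by
    by_cases hc : NeedsSplit n t f k c
    · simp only [encode, if_pos hc, LabelledTree.cost, totalSplitCost]
      push_cast
      gcongr 3 + _ + ?_
      calc _ ≤ ∑ e : Fin d → Fin 2, (7 + 2 * (cellVariation f k c / t k) +
            totalSplitCost n t f h (k + 1) (childIndex c e)) := by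
            refine Finset.sum_le_sum fun e _ => ?_
            refine (cost_encode_le hf ht ht' h (k + 1) (childIndex c e) _).trans ?_
            linarith [natAbs_roundedValue_sub_predictedValue_le hf (ht k) (ht' k) c e]
        _ = 2 ^ d * (7 + 2 * (cellVariation f k c / t k)) +
            ∑ e, totalSplitCost n t f h (k + 1) (childIndex c e) := by
            simp [Finset.sum_add_distrib, mul_add]
        _ ≤ _ := by
            gcongr
            exact children_label_cost_le (ht k) hc
    · simp only [encode, if_neg hc, LabelledTree.cost, Nat.cast_add, Nat.cast_ofNat]
      exact le_add_of_nonneg_right (totalSplitCost_nonneg ht (h + 1) k c)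

lemma sum_splitCost_le (hf : f ∈ monotoneClass d) {k : ℕ} (ht : 0 < t k) :
    ∑ c ∈ cells d k, splitCost n t f k c ≤
      2 ^ d * ((if k < n then 7 * ((2 : ℝ) ^ k) ^ d else 0) +
        9 * (d * 2 ^ d * ((2 : ℝ) ^ k) ^ (d - 1) / t k)) := by
  unfold splitCost
  rw [← Finset.mul_sum, Finset.sum_add_distrib, ← Finset.mul_sum, ← Finset.sum_div]
  gcongr
  · rw [Finset.sum_const, card_cells]
    split_ifs <;> simp [mul_comm]
  · exact sum_cellVariation_le hf k

lemma cost_code_le (hf : f ∈ monotoneClass d) (ht : ∀ k, 0 < t k)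
    (ht' : ∀ k, t k ≤ 2 * t (k + 1)) (ht0 : t 0 = 1) (K : ℕ) :
    ((code n t K f).cost : ℝ) ≤ costBound d n t K := by
  have hroot : ((roundedValue t f 0 0 - 0).natAbs : ℝ) ≤ 1 := by
    have hfx := hf.1 (lowerCorner 0 0)
    rw [sub_zero, roundedValue, ht0, div_one, Nat.cast_natAbs, Int.cast_abs, abs_of_nonneg]
    · exact (Int.floor_le _).trans hfx.2
    · exact_mod_cast Int.floor_nonneg.2 hfx.1
  have htotal : totalSplitCost n t f K 0 0 =
      ∑ j ∈ Finset.range K, ∑ c ∈ cells d j, splitCost n t f j c := by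
    simpa only [cells_zero, Finset.sum_singleton, zero_add] using sum_totalSplitCost K 0
  have hsum := Finset.sum_le_sum fun k (_ : k ∈ Finset.range K) =>
    sum_splitCost_le (n := n) hf (ht k)
  have hcost := cost_encode_le (n := n) hf ht ht' K 0 0 0
  rw [htotal] at hcost
  unfold costBound code
  linarith

end Cost

/-! ### Brackets from codes -/

lemma exists_hasLpBracketing_of_code {d : ℕ} {F : Set (UnitCube d → ℝ)} {p ε : ℝ} {α : Type*}
    (φ : (UnitCube d → ℝ) → α) (lo hi : (UnitCube d → ℝ) → UnitCube d → ℝ) (s : Finset α)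
    (hs : ∀ f ∈ F, φ f ∈ s)
    (hbracket : ∀ g ∈ F, MemLp (lo g) (ENNReal.ofReal p) volume ∧
      MemLp (hi g) (ENNReal.ofReal p) volume ∧
      eLpNorm (hi g - lo g) (ENNReal.ofReal p) volume ≤ ENNReal.ofReal ε)
    (hmem : ∀ f ∈ F, ∀ g ∈ F, φ f = φ g → lo g ≤ f ∧ f ≤ hi g) :
    ∃ m ≤ s.card, HasLpBracketing F p ε m := by
  have hfin : (φ '' F).Finite := s.finite_toSet.subset (Set.image_subset_iff.2 hs)
  have hcard : hfin.toFinset.card ≤ s.card :=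
    Finset.card_le_card (hfin.toFinset_subset.2 (Set.image_subset_iff.2 hs))
  refine ⟨hfin.toFinset.card, hcard, ?_⟩
  let index := hfin.toFinset.equivFin
  have hrep : ∀ k, ∃ g ∈ F, φ g = (index.symm k).1 := fun k => hfin.mem_toFinset.1 (index.symm k).2
  choose g hg hgk using hrep
  refine ⟨fun k => lo (g k), fun k => hi (g k), fun k => hbracket _ (hg k), fun f hf => ?_⟩
  have hf' : φ f ∈ hfin.toFinset := hfin.mem_toFinset.2 (Set.mem_image_of_mem _ hf)
  refine ⟨index ⟨_, hf'⟩, hmem f hf _ (hg _) ?_⟩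
  rw [hgk, Equiv.symm_apply_apply]

/-- The value of `g` at the lower corner of the cell of its adaptive partition that contains `x`. -/
noncomputable def leafValue {d : ℕ} (n : ℕ) (t : ℕ → ℝ) (K : ℕ) (g : UnitCube d → ℝ)
    (x : UnitCube d) : ℝ :=
  g (lowerCorner (leafLevel n t g x K 0) (cellIndex (leafLevel n t g x K 0) x))

/-- The threshold at the level of the cell of the adaptive partition that contains `x`; twice this
number is the distance from the leaf value to the ends of the bracket. -/
noncomputable def leafWidth {d : ℕ} (n : ℕ) (t : ℕ → ℝ) (K : ℕ) (g : UnitCube d → ℝ)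
    (x : UnitCube d) : ℝ :=
  t (leafLevel n t g x K 0)

/-- The bound for the `p`-th power of the size of the brackets. -/
noncomputable def errorBound (d : ℕ) (p : ℝ) (n : ℕ) (t : ℕ → ℝ) (K : ℕ) : ℝ :=
  (4 * t n) ^ p + ∑ k ∈ Finset.Ico n K,
    (4 * t (k + 1)) ^ p / t k * (d * 2 ^ d * ((2 : ℝ) ^ k)⁻¹)

lemma measurable_apply_nat {α β : Type*} [MeasurableSpace α] [MeasurableSpace β] {F : ℕ → α → β}
    (hF : ∀ k, Measurable (F k)) {l : α → ℕ} (hl : Measurable l) :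
    Measurable fun x => F (l x) x :=
  (measurable_from_prod_countable_left (f := fun q : α × ℕ => F q.2 q.1) hF).comp
    (measurable_id.prodMk hl)

lemma abs_sub_le_of_floor_eq {a b s : ℝ} (hs : 0 < s) (h : ⌊a / s⌋ = ⌊b / s⌋) : |a - b| ≤ s := by
  have := (Int.abs_sub_lt_one_of_floor_eq_floor h).le
  rwa [← sub_div, abs_div, abs_of_pos hs, div_le_one hs] at this

section Bracket

variable {d : ℕ} {n : ℕ} {t : ℕ → ℝ} {f g : UnitCube d → ℝ} {K : ℕ}

lemma measurable_leafValue : Measurable (leafValue n t K g) :=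
  measurable_apply_nat (F := fun k x => g (lowerCorner k (cellIndex k x)))
    (fun k => (Measurable.of_discrete (f := fun c => g (lowerCorner k c))).comp
      (measurable_cellIndex k)) (measurable_leafLevel K 0)

lemma measurable_leafWidth : Measurable (leafWidth n t K g) :=
  (measurable_from_top (f := t)).comp (measurable_leafLevel K 0)

lemma abs_sub_leafValue_le (hf : f ∈ monotoneClass d) (ht : ∀ k, 0 < t k) (htK : 1 ≤ t K)
    (hfg : code n t K f = code n t K g) (x : UnitCube d) :
    |f x - leafValue n t K g x| ≤ 2 * leafWidth n t K g x := by
  obtain ⟨hlevel, hround⟩ := leafLevel_eq_of_code_eq hfg x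
  have hleaf := abs_sub_leaf_le (n := n) hf htK x
  rw [hlevel] at hleaf
  have hvalue := abs_sub_le_of_floor_eq (ht _) hround
  rw [two_mul]
  exact (abs_sub_le _ _ _).trans (add_le_add hleaf hvalue)

lemma abs_leafWidth_le (x : UnitCube d) :
    |leafWidth n t K g x| ≤ ∑ k ∈ Finset.range (K + 1), |t k| := by
  have hlevel := leafLevel_le (n := n) (t := t) (f := g) x K 0
  exact Finset.single_le_sum (f := fun k => |t k|) (fun _ _ => abs_nonneg _)
    (Finset.mem_range.2 (by omega))

lemma memLp_leaf (hg : g ∈ monotoneClass d) (r : ℝ) (p : ℝ≥0∞) :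
    MemLp (fun x => leafValue n t K g x + r * leafWidth n t K g x) p volume := by
  refine MemLp.of_bound
    (measurable_leafValue.add (measurable_leafWidth.const_mul r)).aestronglyMeasurable
    (1 + |r| * ∑ k ∈ Finset.range (K + 1), |t k|) (Filter.Eventually.of_forall fun x => ?_)
  have hvalue : leafValue n t K g x ∈ Set.Icc 0 1 := hg.1 _
  refine (norm_add_le _ _).trans (add_le_add ?_ ?_)
  · rw [Real.norm_eq_abs, abs_of_nonneg hvalue.1]
    exact hvalue.2
  · rw [Real.norm_eq_abs, abs_mul]
    exact mul_le_mul_of_nonneg_left (abs_leafWidth_le x) (abs_nonneg r)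

lemma rpow_leafWidth_le (ht : ∀ k, 0 < t k) (hn : n ≤ K) (p : ℝ) (x : UnitCube d) :
    (4 * leafWidth n t K g x) ^ p ≤ (4 * t n) ^ p + ∑ k ∈ Finset.Ico n K,
      (4 * t (k + 1)) ^ p / t k * cellVariation g k (cellIndex k x) := by
  have hpow : ∀ k, 0 ≤ (4 * t k) ^ p := fun k => by have := ht k; positivity
  have hterm : ∀ k, 0 ≤ (4 * t (k + 1)) ^ p / t k * cellVariation g k (cellIndex k x) := fun k =>
    mul_nonneg (div_nonneg (hpow _) (ht k).le) (cellVariation_nonneg g k _)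
  have hle := leafLevel_le (n := n) (t := t) (f := g) x K 0
  unfold leafWidth
  rcases (le_leafLevel_root (t := t) (f := g) x hn).eq_or_lt with h | h
  · rw [← h]
    exact le_add_of_nonneg_right (Finset.sum_nonneg fun k _ => hterm k)
  -- Beyond level `n`, the variation over the parent of the leaf exceeds its threshold.
  · obtain ⟨k, hk⟩ := Nat.exists_eq_add_one_of_ne_zero (Nat.ne_zero_of_lt h)
    have hparent : t k < cellVariation g k (cellIndex k x) :=
      (needsSplit_of_lt_leafLevel (n := n) (t := t) (f := g) x K 0 k (Nat.zero_le k)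
        (by omega)).resolve_left (by omega)
    rw [hk]
    calc (4 * t (k + 1)) ^ p ≤ (4 * t (k + 1)) ^ p / t k * cellVariation g k (cellIndex k x) := by
          rw [div_mul_eq_mul_div, le_div_iff₀ (ht k)]
          exact mul_le_mul_of_nonneg_left hparent.le (hpow _)
      _ ≤ ∑ k ∈ Finset.Ico n K, (4 * t (k + 1)) ^ p / t k * cellVariation g k (cellIndex k x) :=
          Finset.single_le_sum
            (f := fun k => (4 * t (k + 1)) ^ p / t k * cellVariation g k (cellIndex k x))
            (fun k _ => hterm k) (Finset.mem_Ico.2 ⟨by omega, by omega⟩)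
      _ ≤ _ := le_add_of_nonneg_left (hpow n)

lemma lintegral_cellVariation_le (hg : g ∈ monotoneClass d) (k : ℕ) :
    ∫⁻ x : UnitCube d, ENNReal.ofReal (cellVariation g k (cellIndex k x)) ≤
      ENNReal.ofReal (d * 2 ^ d * ((2 : ℝ) ^ k)⁻¹) := by
  rw [lintegral_comp_cellIndex k fun c => ENNReal.ofReal (cellVariation g k c),
    ← ENNReal.ofReal_sum_of_nonneg fun c _ => cellVariation_nonneg g k c,
    ← ENNReal.ofReal_mul (Finset.sum_nonneg fun c _ => cellVariation_nonneg g k c)]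
  apply ENNReal.ofReal_le_ofReal
  calc _ ≤ d * 2 ^ d * ((2 : ℝ) ^ k) ^ (d - 1) * ((2 : ℝ) ^ k)⁻¹ ^ d := by
        gcongr
        exact sum_cellVariation_le hg k
    _ = _ := by
        rcases d with _ | m
        · simp
        · rw [Nat.add_sub_cancel, pow_succ _⁻¹, inv_pow, mul_assoc,
            mul_inv_cancel_left₀ (by positivity)]

lemma measurable_cellVariation_cellIndex (g : UnitCube d → ℝ) (k : ℕ) :
    Measurable fun x : UnitCube d => cellVariation g k (cellIndex k x) :=
  (Measurable.of_discrete (f := cellVariation g k)).comp (measurable_cellIndex k)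

lemma lintegral_rpow_leafWidth_le (hg : g ∈ monotoneClass d) (ht : ∀ k, 0 < t k) (hn : n ≤ K)
    (p : ℝ) : ∫⁻ x, ENNReal.ofReal ((4 * leafWidth n t K g x) ^ p) ≤
      ENNReal.ofReal (errorBound d p n t K) := by
  have hpow : ∀ k, 0 ≤ (4 * t k) ^ p := fun k => by have := ht k; positivity
  have hcoeff : ∀ k, 0 ≤ (4 * t (k + 1)) ^ p / t k := fun k => div_nonneg (hpow _) (ht k).le
  have hvar : ∀ k x, 0 ≤ cellVariation g k (cellIndex k x) := fun k x => cellVariation_nonneg g k _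
  have hmeas : ∀ k, Measurable fun x : UnitCube d =>
      ENNReal.ofReal (cellVariation g k (cellIndex k x)) := fun k =>
    (measurable_cellVariation_cellIndex g k).ennreal_ofReal
  calc ∫⁻ x, ENNReal.ofReal ((4 * leafWidth n t K g x) ^ p)
      ≤ ∫⁻ x : UnitCube d, (ENNReal.ofReal ((4 * t n) ^ p) + ∑ k ∈ Finset.Ico n K,
          ENNReal.ofReal ((4 * t (k + 1)) ^ p / t k) *
            ENNReal.ofReal (cellVariation g k (cellIndex k x))) := by
        refine lintegral_mono fun x =>
          (ENNReal.ofReal_le_ofReal (rpow_leafWidth_le ht hn p x)).trans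
            (ENNReal.ofReal_add_le.trans ?_)
        rw [ENNReal.ofReal_sum_of_nonneg fun k _ => mul_nonneg (hcoeff k) (hvar k x)]
        simp_rw [ENNReal.ofReal_mul (hcoeff _)]
        exact le_rfl
    _ = ENNReal.ofReal ((4 * t n) ^ p) + ∑ k ∈ Finset.Ico n K,
          ENNReal.ofReal ((4 * t (k + 1)) ^ p / t k) *
            ∫⁻ x : UnitCube d, ENNReal.ofReal (cellVariation g k (cellIndex k x)) := by
        rw [lintegral_add_left measurable_const, lintegral_const, measure_univ, mul_one,
          lintegral_finsetSum _ fun k _ => (hmeas k).const_mul _]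
        simp_rw [lintegral_const_mul _ (hmeas _)]
    _ ≤ ENNReal.ofReal ((4 * t n) ^ p) + ∑ k ∈ Finset.Ico n K,
          ENNReal.ofReal ((4 * t (k + 1)) ^ p / t k * (d * 2 ^ d * ((2 : ℝ) ^ k)⁻¹)) := by
        gcongr with k
        rw [ENNReal.ofReal_mul (hcoeff k)]
        gcongr
        exact lintegral_cellVariation_le hg k
    _ = _ := by
        have hsummand : ∀ k ∈ Finset.Ico n K,
            0 ≤ (4 * t (k + 1)) ^ p / t k * (d * 2 ^ d * ((2 : ℝ) ^ k)⁻¹) := fun k _ =>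
          mul_nonneg (hcoeff k) (by positivity)
        rw [errorBound, ENNReal.ofReal_add (hpow n) (Finset.sum_nonneg hsummand),
          ENNReal.ofReal_sum_of_nonneg hsummand]

lemma eLpNorm_leafWidth_le (hg : g ∈ monotoneClass d) (ht : ∀ k, 0 < t k) (hn : n ≤ K) {p ε : ℝ}
    (hp : 0 < p) (hε : 0 ≤ ε) (herror : errorBound d p n t K ≤ ε ^ p) :
    eLpNorm (fun x => 4 * leafWidth n t K g x) (ENNReal.ofReal p) volume ≤ ENNReal.ofReal ε := by
  have hwidth : ∀ x, 0 ≤ 4 * leafWidth n t K g x := fun x => mul_nonneg (by norm_num) (ht _).le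
  rw [eLpNorm_eq_lintegral_rpow_enorm_toReal (by simpa using hp) ENNReal.ofReal_ne_top,
    ENNReal.toReal_ofReal hp.le, one_div, ENNReal.rpow_inv_le_iff hp,
    ENNReal.ofReal_rpow_of_nonneg hε hp.le]
  simp_rw [Real.enorm_eq_ofReal (hwidth _), ENNReal.ofReal_rpow_of_nonneg (hwidth _) hp.le]
  exact (lintegral_rpow_leafWidth_le hg ht hn p).trans (ENNReal.ofReal_le_ofReal herror)

lemma exists_hasLpBracketing (ht : ∀ k, 0 < t k) (ht' : ∀ k, t k ≤ 2 * t (k + 1)) (ht0 : t 0 = 1)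
    (hn : n ≤ K) (htK : 1 ≤ t K) {p ε : ℝ} (hp : 0 < p) (hε : 0 ≤ ε)
    (herror : errorBound d p n t K ≤ ε ^ p) :
    ∃ m : ℕ, HasLpBracketing (monotoneClass d) p ε m ∧
      (m : ℝ) ≤ Real.exp (costBound d n t K) := by
  obtain ⟨hfin, hcard⟩ := LabelledTree.exists_finite_card_cost_le (E := Fin d → Fin 2) K
    ⌊costBound d n t K⌋₊
  have hcost : 0 ≤ costBound d n t K :=
    add_nonneg (by norm_num) (Finset.sum_nonneg fun k _ => by have := ht k; positivity)
  let lo (g : UnitCube d → ℝ) (x : UnitCube d) := leafValue n t K g x + -2 * leafWidth n t K g x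
  let hi (g : UnitCube d → ℝ) (x : UnitCube d) := leafValue n t K g x + 2 * leafWidth n t K g x
  have hsize (g) (hg : g ∈ monotoneClass d) :
      eLpNorm (hi g - lo g) (ENNReal.ofReal p) volume ≤ ENNReal.ofReal ε := by
    convert eLpNorm_leafWidth_le hg ht hn hp hε herror using 2
    funext x
    simp only [hi, lo, Pi.sub_apply]
    ring
  have hmem (f) (hf : f ∈ monotoneClass d) (g) (_ : g ∈ monotoneClass d)
      (hfg : code n t K f = code n t K g) : lo g ≤ f ∧ f ≤ hi g := by
    have hclose := fun x => abs_le.1 (abs_sub_leafValue_le hf ht htK hfg x)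
    exact ⟨fun x => by linarith [(hclose x).1], fun x => by linarith [(hclose x).2]⟩
  obtain ⟨m, hm, hbracketing⟩ := exists_hasLpBracketing_of_code (code n t K) lo hi hfin.toFinset
    (fun f hf => hfin.mem_toFinset.2 (Nat.le_floor (cost_code_le hf ht ht' ht0 K)))
    (fun g hg => ⟨memLp_leaf hg _ _, memLp_leaf hg _ _, hsize g hg⟩) hmem
  refine ⟨m, hbracketing, ?_⟩
  calc (m : ℝ) ≤ 2 ^ ⌊costBound d n t K⌋₊ := mod_cast hm.trans hcard
    _ ≤ Real.exp 1 ^ ⌊costBound d n t K⌋₊ := by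
      gcongr
      linarith [Real.add_one_le_exp (1 : ℝ)]
    _ = Real.exp ⌊costBound d n t K⌋₊ := by rw [← Real.exp_nat_mul, mul_one]
    _ ≤ Real.exp (costBound d n t K) := Real.exp_le_exp.2 (Nat.floor_le hcost)

end Bracket

/-! ### Upper bounds for the bracketing entropy -/

lemma lpBracketingEntropy_le {d : ℕ} {F : Set (UnitCube d → ℝ)} {p ε L : ℝ} {m : ℕ}
    (hm : HasLpBracketing F p ε m) (hL : (m : ℝ) ≤ Real.exp L) :
    lpBracketingEntropy F p ε ≤ (L : EReal) := by
  have hnumber : (lpBracketingNumber F p ε : ℝ≥0∞) ≤ ENNReal.ofReal (Real.exp L) := by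
    refine (ENat.toENNReal_le.2 (iInf₂_le m hm : lpBracketingNumber F p ε ≤ m)).trans ?_
    rw [ENat.toENNReal_coe, ← ENNReal.ofReal_natCast]
    exact ENNReal.ofReal_le_ofReal hL
  refine (ENNReal.log_le_log hnumber).trans ?_
  rw [ENNReal.log_ofReal_of_pos (Real.exp_pos L), Real.log_exp]

/-- The thresholds of the adaptive partitions: `2 ^ (-k)` down to level `n`, and growing with the
exponential rate `β` from there on. -/
noncomputable def threshold (n : ℕ) (β : ℝ) (k : ℕ) : ℝ :=
  2 ^ max (-(k : ℝ)) (β * ((k : ℝ) - n) - n)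

section Threshold

variable {d n k : ℕ} {β : ℝ}

lemma threshold_pos (n : ℕ) (β : ℝ) (k : ℕ) : 0 < threshold n β k :=
  Real.rpow_pos_of_pos two_pos _

lemma threshold_of_le (hβ : 0 ≤ β) (hk : k ≤ n) : threshold n β k = (2 : ℝ) ^ (-(k : ℝ)) := by
  have hkn : (k : ℝ) ≤ n := mod_cast hk
  rw [threshold, max_eq_left]
  nlinarith

lemma threshold_zero (n : ℕ) (hβ : 0 ≤ β) : threshold n β 0 = 1 := by
  simp [threshold_of_le hβ n.zero_le]

lemma threshold_add (hβ : 0 ≤ β) (n j : ℕ) : threshold n β (n + j) = (2 : ℝ) ^ (β * j - n) := by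
  rw [threshold, Nat.cast_add, add_sub_cancel_left, max_eq_right]
  have : 0 ≤ β * j := by positivity
  linarith [j.cast_nonneg (α := ℝ)]

lemma threshold_le_two_mul (hβ : 0 ≤ β) (n k : ℕ) :
    threshold n β k ≤ 2 * threshold n β (k + 1) := by
  calc threshold n β k ≤ (2 : ℝ) ^ (1 + max (-((k + 1 : ℕ) : ℝ)) (β * ((k + 1 : ℕ) - n) - n)) := by
        refine Real.rpow_le_rpow_of_exponent_le one_le_two ?_
        rw [← max_add_add_left]
        push_cast
        exact max_le_max (by linarith) (by linarith)
    _ = 2 * threshold n β (k + 1) := by rw [Real.rpow_add two_pos, Real.rpow_one, threshold]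

lemma errorBound_threshold (hβ : 0 ≤ β) (p : ℝ) (n J : ℕ) :
    errorBound d p n (threshold n β) (n + J) = 4 ^ p * (2 : ℝ) ^ (-(n * p)) *
      (1 + 2 ^ (β * p) * (d * 2 ^ d) *
        ∑ j ∈ Finset.range J, (2 : ℝ) ^ ((β * (p - 1) - 1) * j)) := by
  have hpow (j : ℕ) : (4 * threshold n β (n + j)) ^ p = 4 ^ p * 2 ^ ((β * j - n) * p) := by
    rw [threshold_add hβ, Real.mul_rpow (by norm_num) (by positivity), ← Real.rpow_mul two_pos.le]
  have hfirst : (4 * threshold n β n) ^ p = 4 ^ p * 2 ^ (-(n * p)) := by simpa using hpow 0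
  have hsummand (j : ℕ) : (4 * threshold n β (n + j + 1)) ^ p / threshold n β (n + j) *
      (d * 2 ^ d * ((2 : ℝ) ^ (n + j))⁻¹) = 4 ^ p * (2 : ℝ) ^ (-(n * p)) *
        (2 ^ (β * p) * (d * 2 ^ d) * 2 ^ ((β * (p - 1) - 1) * j)) := by
    have hexp : (2 : ℝ) ^ ((β * (j + 1 : ℕ) - n) * p) / 2 ^ (β * j - n) * (2 ^ (n + j))⁻¹ =
        2 ^ (-(n * p)) * 2 ^ (β * p) * 2 ^ ((β * (p - 1) - 1) * j) := by
      rw [← Real.rpow_natCast 2 (n + j), ← Real.rpow_neg two_pos.le, ← Real.rpow_sub two_pos,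
        ← Real.rpow_add two_pos, ← Real.rpow_add two_pos, ← Real.rpow_add two_pos]
      congr 1
      push_cast
      ring
    rw [add_assoc, hpow, threshold_add hβ]
    linear_combination 4 ^ p * (d * 2 ^ d) * hexp
  rw [errorBound, Finset.sum_Ico_eq_sum_range, Nat.add_sub_cancel_left,
    Finset.sum_congr rfl fun j _ => hsummand j, ← Finset.mul_sum, ← Finset.mul_sum, hfirst]
  ring

lemma sum_range_pow_le_pow {x : ℝ} (hx : 2 ≤ x) (n : ℕ) : ∑ k ∈ Finset.range n, x ^ k ≤ x ^ n := by
  have hgeom := geom_sum_mul x n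
  have hsum : 0 ≤ ∑ k ∈ Finset.range n, x ^ k := Finset.sum_nonneg fun k _ => by positivity
  nlinarith

lemma costBound_summand_of_lt (hd : 1 ≤ d) (hβ : 0 ≤ β) (hk : k < n) :
    2 ^ d * ((if k < n then 7 * ((2 : ℝ) ^ k) ^ d else 0) +
      9 * (d * 2 ^ d * ((2 : ℝ) ^ k) ^ (d - 1) / threshold n β k)) =
        2 ^ d * (7 + 9 * (d * 2 ^ d)) * ((2 : ℝ) ^ d) ^ k := by
  have hpow : ((2 : ℝ) ^ k) ^ (d - 1) * 2 ^ k = ((2 : ℝ) ^ k) ^ d := pow_sub_one_mul (by omega) _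
  rw [if_pos hk, threshold_of_le hβ hk.le, Real.rpow_neg two_pos.le, Real.rpow_natCast,
    div_inv_eq_mul, pow_right_comm 2 d k]
  linear_combination 2 ^ d * 9 * (d * 2 ^ d) * hpow

lemma costBound_summand_add (hd : 1 ≤ d) (hβ : 0 ≤ β) (n j : ℕ) :
    2 ^ d * ((if n + j < n then 7 * ((2 : ℝ) ^ (n + j)) ^ d else 0) +
      9 * (d * 2 ^ d * ((2 : ℝ) ^ (n + j)) ^ (d - 1) / threshold n β (n + j))) =
        2 ^ d * (9 * (d * 2 ^ d)) * 2 ^ ((n : ℝ) * d) * 2 ^ (((d : ℝ) - 1 - β) * j) := by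
  have hexp : ((2 : ℝ) ^ (n + j)) ^ (d - 1) / threshold n β (n + j) =
      2 ^ ((n : ℝ) * d) * 2 ^ (((d : ℝ) - 1 - β) * j) := by
    rw [threshold_add hβ, ← pow_mul, ← Real.rpow_natCast, ← Real.rpow_sub two_pos,
      ← Real.rpow_add two_pos]
    congr 1
    push_cast [hd]
    ring
  rw [if_neg (by omega), mul_div_assoc, hexp]
  ring

lemma costBound_threshold_le (hd : 1 ≤ d) (hβ : 0 ≤ β) (n J : ℕ) :
    costBound d n (threshold n β) (n + J) ≤ (4 + 2 ^ d * (7 + 9 * (d * 2 ^ d))) *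
      (2 : ℝ) ^ ((n : ℝ) * d) * (1 + ∑ j ∈ Finset.range J, (2 : ℝ) ^ (((d : ℝ) - 1 - β) * j)) := by
  have hgeom : ∑ k ∈ Finset.range n, ((2 : ℝ) ^ d) ^ k ≤ 2 ^ ((n : ℝ) * d) := by
    rw [mul_comm, Real.rpow_mul two_pos.le, Real.rpow_natCast, Real.rpow_natCast]
    exact sum_range_pow_le_pow (le_self_pow₀ one_le_two (by omega)) n
  have hone : (1 : ℝ) ≤ 2 ^ ((n : ℝ) * d) := Real.one_le_rpow one_le_two (by positivity)
  rw [costBound, Finset.sum_range_add, Finset.sum_congr rfl fun k hk =>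
      costBound_summand_of_lt hd hβ (Finset.mem_range.1 hk),
    Finset.sum_congr rfl fun j _ => costBound_summand_add hd hβ n j, ← Finset.mul_sum,
    ← Finset.mul_sum]
  set A : ℝ := d * 2 ^ d
  have hA : 0 ≤ A := by positivity
  set S := ∑ j ∈ Finset.range J, (2 : ℝ) ^ (((d : ℝ) - 1 - β) * j)
  have hS : 0 ≤ S := by positivity
  calc _ ≤ 4 * (2 : ℝ) ^ ((n : ℝ) * d) * (1 + S) + (2 ^ d * (7 + 9 * A) * 2 ^ ((n : ℝ) * d) +
        2 ^ d * (7 + 9 * A) * 2 ^ ((n : ℝ) * d) * S) := by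
        gcongr
        · nlinarith
        · linarith
    _ = _ := by ring

lemma exists_lpBracketingEntropy_le_of_slope (hd : 1 ≤ d) {p : ℝ} (hp : 0 < p) (hβ : 0 ≤ β) :
    ∃ C : ℝ, 0 < C ∧ ∀ (n J : ℕ) (ε : ℝ), n ≤ β * J → 0 ≤ ε →
      C * (2 : ℝ) ^ (-(n * p)) *
        (1 + ∑ j ∈ Finset.range J, (2 : ℝ) ^ ((β * (p - 1) - 1) * j)) ≤ ε ^ p →
      lpBracketingEntropy (monotoneClass d) p ε ≤ ((C * (2 : ℝ) ^ ((n : ℝ) * d) *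
        (1 + ∑ j ∈ Finset.range J, (2 : ℝ) ^ (((d : ℝ) - 1 - β) * j)) : ℝ) : EReal) := by
  set A : ℝ := 2 ^ (β * p) * (d * 2 ^ d)
  set B : ℝ := 4 + 2 ^ d * (7 + 9 * (d * 2 ^ d))
  refine ⟨max (4 ^ p * (1 + A)) B, by positivity, fun n J ε hJ hε herror => ?_⟩
  have hlast : 1 ≤ threshold n β (n + J) := by
    rw [threshold_add hβ]
    exact Real.one_le_rpow one_le_two (by linarith)
  have hsize : errorBound d p n (threshold n β) (n + J) ≤ ε ^ p := by
    rw [errorBound_threshold hβ]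
    refine le_trans ?_ herror
    set S := ∑ j ∈ Finset.range J, (2 : ℝ) ^ ((β * (p - 1) - 1) * j)
    have hS : 0 ≤ S := by positivity
    have hA : 0 ≤ A := by positivity
    calc 4 ^ p * (2 : ℝ) ^ (-(n * p)) * (1 + A * S)
        ≤ 4 ^ p * (2 : ℝ) ^ (-(n * p)) * ((1 + A) * (1 + S)) := by
          gcongr
          nlinarith
      _ = 4 ^ p * (1 + A) * (2 : ℝ) ^ (-(n * p)) * (1 + S) := by ring
      _ ≤ _ := by
          gcongr
          exact le_max_left _ _
  obtain ⟨m, hm, hmL⟩ := exists_hasLpBracketing (threshold_pos n β) (threshold_le_two_mul hβ n)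
    (threshold_zero n hβ) (Nat.le_add_right n J) hlast hp hε hsize
  refine lpBracketingEntropy_le hm (hmL.trans (Real.exp_le_exp.2 ?_))
  refine (costBound_threshold_le hd hβ n J).trans ?_
  gcongr
  exact le_max_right _ _

end Threshold

lemma exists_one_add_sum_le_of_ne_zero {β γ : ℝ} (hβ : 0 < β) (hγ : γ ≠ 0) :
    ∃ C : ℝ, ∀ n : ℕ, 1 + ∑ j ∈ Finset.range ⌈n / β⌉₊, (2 : ℝ) ^ (γ * j) ≤
      C * 2 ^ (n * (max γ 0 / β)) := by
  have hconv (j : ℕ) : (2 : ℝ) ^ (γ * j) = ((2 : ℝ) ^ γ) ^ j := by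
    rw [Real.rpow_mul two_pos.le, Real.rpow_natCast]
  have hratio : (0 : ℝ) < 2 ^ γ := by positivity
  simp only [hconv]
  rcases hγ.lt_or_gt with h | h
  · have hlt : (2 : ℝ) ^ γ < 1 := Real.rpow_lt_one_of_one_lt_of_neg one_lt_two h
    refine ⟨1 + (1 - 2 ^ γ)⁻¹, fun n => ?_⟩
    rw [max_eq_right h.le, zero_div, mul_zero, Real.rpow_zero, mul_one,
      ← tsum_geometric_of_lt_one hratio.le hlt]
    gcongr
    exact (summable_geometric_of_lt_one hratio.le hlt).sum_le_tsum _ fun _ _ => by positivity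
  · have hgt : 0 < (2 : ℝ) ^ γ - 1 := by linarith [Real.one_lt_rpow one_lt_two h]
    refine ⟨1 + (2 : ℝ) ^ γ / (2 ^ γ - 1), fun n => ?_⟩
    rw [max_eq_left h.le]
    have hone : (1 : ℝ) ≤ 2 ^ (n * (γ / β)) := Real.one_le_rpow one_le_two (by positivity)
    have hlast : ((2 : ℝ) ^ γ) ^ ⌈n / β⌉₊ ≤ 2 ^ γ * 2 ^ (n * (γ / β)) := by
      rw [← hconv, ← Real.rpow_add two_pos]
      apply Real.rpow_le_rpow_of_exponent_le one_le_two
      calc γ * ⌈n / β⌉₊ ≤ γ * (n / β + 1) := by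
            gcongr
            exact (Nat.ceil_lt_add_one (by positivity)).le
        _ = _ := by ring
    rw [geom_sum_eq (by linarith), add_mul, one_mul, div_mul_eq_mul_div]
    gcongr
    linarith

lemma exists_slope_of_lt {d p : ℝ} (hd : 1 ≤ d) (hp : 1 ≤ p) (hpd : (d - 1) * p < d) :
    ∃ β : ℝ, 0 < β ∧ d - 1 < β ∧ β * (p - 1) < 1 := by
  rcases hp.eq_or_lt with rfl | hp
  · exact ⟨d, by linarith, by linarith, by simp⟩
  · have hp : 0 < p - 1 := by linarith
    have hlt : d - 1 < 1 / (p - 1) := by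
      rw [lt_div_iff₀ hp]
      linarith
    obtain ⟨β, hβd, hβp⟩ := exists_between hlt
    exact ⟨β, by linarith, hβd, (lt_div_iff₀ hp).1 hβp⟩

lemma exists_slope_of_gt {d p : ℝ} (hp : 1 ≤ p) (hpd : d < (d - 1) * p) :
    ∃ β : ℝ, 0 < β ∧ β < d - 1 ∧ 1 < β * (p - 1) := by
  have hp : 0 < p - 1 := by
    rcases hp.eq_or_lt with rfl | hp
    · linarith
    · linarith
  have hlt : 1 / (p - 1) < d - 1 := by
    rw [div_lt_iff₀ hp]
    linarith
  obtain ⟨β, hβp, hβd⟩ := exists_between hlt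
  exact ⟨β, (one_div_pos.2 hp).trans hβp, hβd, (div_lt_iff₀ hp).1 hβp⟩

lemma exists_nat_le_two_rpow {a y : ℝ} (ha : 0 < a) (hy : 1 ≤ y) :
    ∃ m : ℕ, y ≤ 2 ^ (m * a) ∧ (m : ℝ) ≤ Real.logb 2 y / a + 1 ∧
      ∀ b : ℝ, 0 ≤ b → (2 : ℝ) ^ (m * b) ≤ 2 ^ b * y ^ (b / a) := by
  have hpow (s : ℝ) : (2 : ℝ) ^ (Real.logb 2 y * s) = y ^ s := by
    rw [Real.rpow_mul two_pos.le, Real.rpow_logb two_pos (by norm_num) (by linarith)]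
  have hlog : 0 ≤ Real.logb 2 y := Real.logb_nonneg one_lt_two hy
  have hceil := (Nat.ceil_lt_add_one (div_nonneg hlog ha.le)).le
  refine ⟨⌈Real.logb 2 y / a⌉₊, ?_, hceil, fun b hb => ?_⟩
  · calc y = 2 ^ (Real.logb 2 y * 1) := by rw [hpow, Real.rpow_one]
      _ ≤ _ := by
        refine Real.rpow_le_rpow_of_exponent_le one_le_two ?_
        rw [mul_one, ← div_le_iff₀ ha]
        exact Nat.le_ceil _
  · rw [← hpow, ← Real.rpow_add two_pos]
    refine Real.rpow_le_rpow_of_exponent_le one_le_two ?_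
    calc _ ≤ (Real.logb 2 y / a + 1) * b := by gcongr
      _ = _ := by ring

lemma exists_mul_pow_le_pow (C D : ℝ) (κ : ℕ) {q : ℝ} (hq : 1 < q) :
    ∃ N : ℕ, C * (D * (N + 1)) ^ κ ≤ q ^ N := by
  have hlim := ((tendsto_pow_const_div_const_pow_of_one_lt κ hq).comp
    (Filter.tendsto_add_atTop_nat 1)).const_mul (C * D ^ κ * q)
  rw [mul_zero] at hlim
  obtain ⟨N, hN⟩ := (hlim.eventually_lt_const one_pos).exists
  refine ⟨N, ?_⟩
  have : 0 < q ^ N := by positivity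
  simp only [Function.comp_apply, Nat.cast_add, Nat.cast_one, pow_succ, mul_div_assoc'] at hN
  rw [div_lt_one (by positivity)] at hN
  rw [mul_pow]
  nlinarith

lemma half_le_log_one_div {ε : ℝ} (hε : 0 < ε) (hε' : ε < 1 / 2) : 1 / 2 ≤ Real.log (1 / ε) := by
  have : Real.log 2 ≤ Real.log (1 / ε) := Real.log_le_log two_pos (by
    rw [le_div_iff₀ hε]
    linarith)
  linarith [Real.log_two_gt_d9]

lemma logb_rpow_neg_mul_le {p ε : ℝ} (hp : 0 ≤ p) (κ : ℕ) (hε : 0 < ε) (hε' : ε < 1 / 2) :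
    Real.logb 2 (ε ^ (-p) * (2 * Real.log (1 / ε)) ^ κ) ≤ 2 * (p + 2 * κ) * Real.log (1 / ε) := by
  have hl := half_le_log_one_div hε hε'
  have hlog2 := Real.log_two_gt_d9
  have hlogl : Real.log (2 * Real.log (1 / ε)) ≤ 2 * Real.log (1 / ε) :=
    (Real.log_le_sub_one_of_pos (by linarith)).trans (by linarith)
  rw [Real.logb, Real.log_mul (by positivity) (by positivity), Real.log_rpow hε, Real.log_pow,
    div_le_iff₀ (by linarith)]
  calc -p * Real.log ε + κ * Real.log (2 * Real.log (1 / ε))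
      = p * Real.log (1 / ε) + κ * Real.log (2 * Real.log (1 / ε)) := by
        rw [one_div, Real.log_inv]
        ring
    _ ≤ p * Real.log (1 / ε) + κ * (2 * Real.log (1 / ε)) := by gcongr
    _ = 2 * (p + 2 * κ) * Real.log (1 / ε) * (1 / 2) := by ring
    _ ≤ _ := by
        gcongr
        linarith

lemma exists_level {p a : ℝ} (hp : 0 ≤ p) (ha : 0 < a) (κ : ℕ) :
    ∃ D : ℝ, 0 < D ∧ ∀ ε : ℝ, 0 < ε → ε < 1 / 2 → ∃ m : ℕ,
      (m : ℝ) + 1 ≤ D * Real.log (1 / ε) ∧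
      ε ^ (-p) * (2 * Real.log (1 / ε)) ^ κ ≤ 2 ^ (m * a) ∧
      ∀ b : ℝ, 0 ≤ b →
        (2 : ℝ) ^ (m * b) ≤ 2 ^ b * (ε ^ (-p) * (2 * Real.log (1 / ε)) ^ κ) ^ (b / a) := by
  refine ⟨2 * (p + 2 * κ) / a + 4, by positivity, fun ε hε hε' => ?_⟩
  have hl := half_le_log_one_div hε hε'
  have hone : 1 ≤ ε ^ (-p) * (2 * Real.log (1 / ε)) ^ κ := one_le_mul_of_one_le_of_one_le
    (Real.one_le_rpow_of_pos_of_le_one_of_nonpos hε (by linarith) (by linarith))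
    (one_le_pow₀ (by linarith))
  obtain ⟨m, hle, hm, hpow⟩ := exists_nat_le_two_rpow ha hone
  refine ⟨m, ?_, hle, hpow⟩
  calc (m : ℝ) + 1 ≤ 2 * (p + 2 * κ) * Real.log (1 / ε) / a + 1 + 1 := by
        gcongr
        refine hm.trans ?_
        gcongr
        exact logb_rpow_neg_mul_le hp κ hε hε'
    _ ≤ 2 * (p + 2 * κ) * Real.log (1 / ε) / a + 4 * Real.log (1 / ε) := by linarith
    _ = _ := by ring

lemma two_rpow_add_mul (m N : ℕ) (s : ℝ) :
    (2 : ℝ) ^ ((m + N : ℕ) * s) = (2 ^ s) ^ N * 2 ^ (m * s) := by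
  rw [← Real.rpow_natCast (2 ^ s), ← Real.rpow_mul two_pos.le, ← Real.rpow_add two_pos]
  push_cast
  ring_nf

/- The level `m` makes `2 ^ (m * a)` exceed `ε ^ (-p) * log (1 / ε) ^ κ` up to a constant; the
bounded shift from `m` to `n = m + N` absorbs all constants, because `m + 1` is at most a multiple
of `log (1 / ε)`. -/
lemma exists_scale {p a b C : ℝ} (hp : 0 ≤ p) (ha : 0 < a) (hb : 0 ≤ b) (hC : 0 < C) (κ : ℕ) :
    ∃ c : ℝ, 0 < c ∧ ∀ ε : ℝ, 0 < ε → ε < 1 / 2 → ∃ n : ℕ,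
      C * (n + 1 : ℝ) ^ κ * 2 ^ (-(n * a)) ≤ ε ^ p ∧
      C * (n + 1 : ℝ) ^ κ * 2 ^ (n * b) ≤
        c * ε ^ (-(p * b / a)) * Real.log (1 / ε) ^ (κ * (1 + b / a)) := by
  obtain ⟨D, hD, hlevel⟩ := exists_level hp ha κ
  obtain ⟨N, hN⟩ := exists_mul_pow_le_pow C D κ (Real.one_lt_rpow one_lt_two ha)
  refine ⟨C * (D * (N + 1)) ^ κ * 2 ^ (N * b) * 2 ^ b * 2 ^ (κ * (b / a)), by positivity,
    fun ε hε hε' => ?_⟩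
  obtain ⟨m, hm, hma, hmb⟩ := hlevel ε hε hε'
  have hl : 0 < Real.log (1 / ε) := by linarith [half_le_log_one_div hε hε']
  set l := Real.log (1 / ε)
  have hpoly : C * ((m + N : ℕ) + 1 : ℝ) ^ κ ≤ C * (D * (N + 1)) ^ κ * l ^ κ := by
    rw [mul_assoc, ← mul_pow]
    gcongr
    push_cast
    nlinarith [N.cast_nonneg (α := ℝ), m.cast_nonneg (α := ℝ)]
  refine ⟨m + N, ?_, ?_⟩
  · rw [Real.rpow_neg two_pos.le, ← div_eq_mul_inv, div_le_iff₀ (by positivity), two_rpow_add_mul]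
    calc C * ((m + N : ℕ) + 1 : ℝ) ^ κ ≤ (2 ^ a) ^ N * (2 * l) ^ κ := by
          refine hpoly.trans (mul_le_mul hN ?_ (by positivity) (by positivity))
          gcongr
          linarith
      _ = ε ^ p * ((2 ^ a) ^ N * (ε ^ (-p) * (2 * l) ^ κ)) := by
          rw [Real.rpow_neg hε.le]
          field_simp
      _ ≤ _ := by gcongr
  · calc C * ((m + N : ℕ) + 1 : ℝ) ^ κ * 2 ^ ((m + N : ℕ) * b)
        ≤ C * (D * (N + 1)) ^ κ * l ^ κ *
          ((2 ^ b) ^ N * (2 ^ b * (ε ^ (-p) * (2 * l) ^ κ) ^ (b / a))) := by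
          rw [two_rpow_add_mul]
          refine mul_le_mul hpoly ?_ (by positivity) (by positivity)
          gcongr
          exact hmb b hb
      _ = _ := by
          rw [mul_pow 2 l, Real.mul_rpow (by positivity) (by positivity), ← Real.rpow_mul hε.le,
            Real.mul_rpow (by positivity) (by positivity), ← Real.rpow_natCast 2 κ,
            ← Real.rpow_natCast l κ, ← Real.rpow_mul two_pos.le, ← Real.rpow_mul hl.le,
            mul_one_add, Real.rpow_add hl, ← Real.rpow_natCast (2 ^ b), ← Real.rpow_mul two_pos.le]
          ring_nf

lemma exists_lpBracketingEntropy_le_of_sum_le {d : ℕ} (hd : 1 ≤ d) {p β a b C₁ C₂ : ℝ} (hp : 0 < p)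
    (hβ : 0 < β) (ha : 0 < a) (hb : 0 ≤ b) (κ : ℕ)
    (herror : ∀ n : ℕ, 1 + ∑ j ∈ Finset.range ⌈n / β⌉₊, (2 : ℝ) ^ ((β * (p - 1) - 1) * j) ≤
      C₁ * (n + 1 : ℝ) ^ κ * 2 ^ (n * (p - a)))
    (hcost : ∀ n : ℕ, 1 + ∑ j ∈ Finset.range ⌈n / β⌉₊, (2 : ℝ) ^ (((d : ℝ) - 1 - β) * j) ≤
      C₂ * (n + 1 : ℝ) ^ κ * 2 ^ (n * (b - d))) :
    ∃ c : ℝ, 0 < c ∧ ∀ ε : ℝ, 0 < ε → ε < 1 / 2 → lpBracketingEntropy (monotoneClass d) p ε ≤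
      ((c * ε ^ (-(p * b / a)) * Real.log (1 / ε) ^ (κ * (1 + b / a)) : ℝ) : EReal) := by
  obtain ⟨C, hC, hslope⟩ := exists_lpBracketingEntropy_le_of_slope hd hp hβ.le
  obtain ⟨c, hc, hscale⟩ := exists_scale (C := C * max 1 (max C₁ C₂)) hp.le ha hb
    (mul_pos hC (lt_max_of_lt_left one_pos)) κ
  have hrpow (n : ℕ) (s u : ℝ) : (2 : ℝ) ^ (n * (s + u)) = 2 ^ (n * s) * 2 ^ (n * u) := by
    rw [mul_add, Real.rpow_add two_pos]
  refine ⟨c, hc, fun ε hε hε' => ?_⟩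
  obtain ⟨n, hn, hnb⟩ := hscale ε hε hε'
  refine (hslope n ⌈n / β⌉₊ ε ?_ hε.le (le_trans ?_ hn)).trans
    (EReal.coe_le_coe_iff.2 (le_trans ?_ hnb))
  · rw [← div_le_iff₀' hβ]
    exact Nat.le_ceil _
  · calc _ ≤ C * 2 ^ (-(n * p)) * (max 1 (max C₁ C₂) * (n + 1 : ℝ) ^ κ * 2 ^ (n * (p - a))) := by
          gcongr
          refine (herror n).trans ?_
          gcongr
          exact le_max_of_le_right (le_max_left _ _)
      _ = _ := by
          rw [← mul_neg, ← mul_neg, show -a = -p + (p - a) by ring, hrpow]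
          ring
  · calc _ ≤ C * 2 ^ (n * (d : ℝ)) * (max 1 (max C₁ C₂) * (n + 1 : ℝ) ^ κ * 2 ^ (n * (b - d))) := by
          gcongr
          refine (hcost n).trans ?_
          gcongr
          exact le_max_of_le_right (le_max_right _ _)
      _ = _ := by
          rw [show (2 : ℝ) ^ (n * b) = 2 ^ (n * (d + (b - d))) by ring_nf, hrpow]
          ring

lemma exists_lpBracketingEntropy_le_of_ne {d : ℕ} (hd : 1 ≤ d) {p β : ℝ} (hp : 0 < p)
    (hβ : 0 < β) (herror : β * (p - 1) - 1 ≠ 0) (hcost : (d : ℝ) - 1 - β ≠ 0)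
    (ha : 0 < p - max (β * (p - 1) - 1) 0 / β) :
    ∃ c : ℝ, 0 < c ∧ ∀ ε : ℝ, 0 < ε → ε < 1 / 2 → lpBracketingEntropy (monotoneClass d) p ε ≤
      ((c * ε ^ (-(p * (d + max (d - 1 - β) 0 / β) / (p - max (β * (p - 1) - 1) 0 / β))) : ℝ) :
        EReal) := by
  obtain ⟨C₁, h₁⟩ := exists_one_add_sum_le_of_ne_zero hβ herror
  obtain ⟨C₂, h₂⟩ := exists_one_add_sum_le_of_ne_zero hβ hcost
  simpa using exists_lpBracketingEntropy_le_of_sum_le hd hp hβ ha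
    (b := d + max ((d : ℝ) - 1 - β) 0 / β) (by positivity) 0 (C₁ := C₁) (C₂ := C₂)
    (by simpa using h₁) (by simpa using h₂)

/- Below the critical exponent one may take a slope `β` for which the errors and the costs both
concentrate at level `n`; above it, one for which they both concentrate at the last level. -/
lemma exists_lpBracketingEntropy_le {d : ℕ} (hd : 1 ≤ d) {p : ℝ} (hp : 1 ≤ p)
    (hpd : ((d : ℝ) - 1) * p ≠ d) : ∃ c : ℝ, 0 < c ∧ ∀ ε : ℝ, 0 < ε → ε < 1 / 2 →
      lpBracketingEntropy (monotoneClass d) p ε ≤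
        ((c * ε ^ (-(max (d : ℝ) (((d : ℝ) - 1) * p))) : ℝ) : EReal) := by
  have hp0 : 0 < p := by linarith
  rcases hpd.lt_or_gt with h | h
  · obtain ⟨β, hβ, hβd, hβp⟩ := exists_slope_of_lt (mod_cast hd) hp h
    have herror : max (β * (p - 1) - 1) 0 / β = 0 := by rw [max_eq_right (by linarith), zero_div]
    have hcost : max ((d : ℝ) - 1 - β) 0 / β = 0 := by rw [max_eq_right (by linarith), zero_div]
    have hbound := exists_lpBracketingEntropy_le_of_ne hd hp0 hβ (by linarith) (by linarith)
      (by linarith)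
    rwa [herror, hcost, add_zero, sub_zero, mul_div_cancel_left₀ _ hp0.ne', ← max_eq_left h.le]
      at hbound
  · obtain ⟨β, hβ, hβd, hβp⟩ := exists_slope_of_gt hp h
    have herror : p - max (β * (p - 1) - 1) 0 / β = 1 + 1 / β := by
      rw [max_eq_left (by linarith)]
      field_simp
      ring
    have hcost : d + max ((d : ℝ) - 1 - β) 0 / β = (d - 1) * (1 + 1 / β) := by
      rw [max_eq_left (by linarith)]
      field_simp
      ring
    have hbound := exists_lpBracketingEntropy_le_of_ne hd hp0 hβ (by linarith) (by linarith)
      (by rw [herror]; positivity)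
    rwa [herror, hcost, ← mul_assoc, mul_div_cancel_right₀ _ (by positivity), mul_comm p,
      ← max_eq_right h.le] at hbound

lemma exists_lpBracketingEntropy_le_critical {d : ℕ} (hd : 1 ≤ d) {p : ℝ} (hp : 0 < p)
    (hpd : ((d : ℝ) - 1) * p = d) : ∃ c : ℝ, 0 < c ∧ ∀ ε : ℝ, 0 < ε → ε < 1 / 2 →
      lpBracketingEntropy (monotoneClass d) p ε ≤
        ((c * ε ^ (-(d : ℝ)) * (Real.log (1 / ε)) ^ (1 + (d : ℝ) / p) : ℝ) : EReal) := by
  have hd0 : (0 : ℝ) < d := mod_cast hd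
  have hβ : 0 < (d : ℝ) - 1 := pos_of_mul_pos_left (by linarith) hp.le
  have hcount (n : ℕ) : 1 + (⌈n / ((d : ℝ) - 1)⌉₊ : ℝ) ≤ (2 + 1 / ((d : ℝ) - 1)) * (n + 1) := by
    have hceil := Nat.ceil_lt_add_one (a := n / ((d : ℝ) - 1)) (by positivity)
    calc 1 + (⌈n / ((d : ℝ) - 1)⌉₊ : ℝ) ≤ n / ((d : ℝ) - 1) + 2 := by linarith
      _ ≤ n / ((d : ℝ) - 1) + 2 + (2 * n + 1 / ((d : ℝ) - 1)) :=
        le_add_of_nonneg_right (by positivity)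
      _ = (2 + 1 / ((d : ℝ) - 1)) * (n + 1) := by ring
  have hslope : ((d : ℝ) - 1) * (p - 1) - 1 = 0 := by linarith
  simpa [hp.ne'] using exists_lpBracketingEntropy_le_of_sum_le hd hp hβ hp hd0.le 1
    (C₁ := 2 + 1 / ((d : ℝ) - 1)) (C₂ := 2 + 1 / ((d : ℝ) - 1))
    (by simpa [hslope] using hcount) (by simpa using hcount)

/-! ### Lower bounds for the entropy -/

lemma HasLpBracketing.hasLpCover {d : ℕ} {F : Set (UnitCube d → ℝ)} {p ε : ℝ} {m : ℕ}
    (h : HasLpBracketing F p ε m) : HasLpCover F p ε m := by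
  obtain ⟨l, u, hlu, hF⟩ := h
  refine ⟨l, fun k => (hlu k).1, fun f hf => ?_⟩
  obtain ⟨k, hlf, hfu⟩ := hF f hf
  refine ⟨k, (eLpNorm_mono_real fun x => ?_).trans (hlu k).2.2⟩
  rw [Pi.sub_apply, Real.norm_of_nonneg (sub_nonneg.2 (hlf x))]
  exact sub_le_sub_right (hfu x) _

lemma lpEntropy_le_lpBracketingEntropy {d : ℕ} (F : Set (UnitCube d → ℝ)) (p ε : ℝ) :
    lpEntropy F p ε ≤ lpBracketingEntropy F p ε :=
  ENNReal.log_le_log <| ENat.toENNReal_le.2 <| le_iInf₂ fun m hm => iInf₂_le m hm.hasLpCover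

lemma le_lpEntropy {d : ℕ} {F : Set (UnitCube d → ℝ)} {p ε L : ℝ}
    (h : ∀ m : ℕ, HasLpCover F p ε m → Real.exp L ≤ m) : (L : EReal) ≤ lpEntropy F p ε := by
  have hceil : (⌈Real.exp L⌉₊ : ℕ∞) ≤ lpCoveringNumber F p ε :=
    le_iInf₂ fun m hm => Nat.cast_le.2 (Nat.ceil_le.2 (h m hm))
  calc (L : EReal) = ENNReal.log (ENNReal.ofReal (Real.exp L)) := by
        rw [ENNReal.log_ofReal_of_pos (Real.exp_pos L), Real.log_exp]
    _ ≤ ENNReal.log ((⌈Real.exp L⌉₊ : ℕ∞) : ℝ≥0∞) := ENNReal.log_le_log <| by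
        rw [ENat.toENNReal_coe]
        exact ENNReal.ofReal_le_natCast.2 (Nat.le_ceil _)
    _ ≤ lpEntropy F p ε := ENNReal.log_le_log (ENat.toENNReal_le.2 hceil)

lemma HasLpCover.card_le_mul {d m : ℕ} {F : Set (UnitCube d → ℝ)} {p ε : ℝ}
    (h : HasLpCover F p ε m) (hp : 1 ≤ p) (hε : 0 ≤ ε) {ι : Type*} {φ : ι → UnitCube d → ℝ}
    (hφF : ∀ i, φ i ∈ F) (hφ : ∀ i, AEStronglyMeasurable (φ i) volume) {T : Finset ι} {M : ℝ}
    (hM : ∀ U ⊆ T, (∀ i ∈ U, ∀ j ∈ U,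
      eLpNorm (φ i - φ j) (ENNReal.ofReal p) volume ≤ ENNReal.ofReal (2 * ε)) → (U.card : ℝ) ≤ M) :
    (T.card : ℝ) ≤ m * M := by
  obtain ⟨g, hg, hgF⟩ := h
  choose c hc using fun i => hgF (φ i) (hφF i)
  have hclose (i j : ι) (hij : c i = c j) :
      eLpNorm (φ i - φ j) (ENNReal.ofReal p) volume ≤ ENNReal.ofReal (2 * ε) :=
    calc eLpNorm (φ i - φ j) (ENNReal.ofReal p) volume
        = eLpNorm ((φ i - g (c i)) - (φ j - g (c i))) (ENNReal.ofReal p) volume := by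
          rw [sub_sub_sub_cancel_right]
      _ ≤ eLpNorm (φ i - g (c i)) (ENNReal.ofReal p) volume +
          eLpNorm (φ j - g (c i)) (ENNReal.ofReal p) volume :=
        eLpNorm_sub_le ((hφ i).sub (hg _).1) ((hφ j).sub (hg _).1) (by simpa using hp)
      _ ≤ ENNReal.ofReal ε + ENNReal.ofReal ε := add_le_add (hc i) (hij ▸ hc j)
      _ = ENNReal.ofReal (2 * ε) := by rw [← ENNReal.ofReal_add hε hε, two_mul]
  calc (T.card : ℝ) = ∑ k : Fin m, ((T.filter fun i => c i = k).card : ℝ) := by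
        exact_mod_cast Finset.card_eq_sum_card_fiberwise fun i _ => Finset.mem_univ (c i)
    _ ≤ ∑ _k : Fin m, M := Finset.sum_le_sum fun k _ =>
        hM _ (Finset.filter_subset _ _) fun i hi j hj =>
          hclose i j ((Finset.mem_filter.1 hi).2.trans (Finset.mem_filter.1 hj).2.symm)
    _ = m * M := by simp

/-- The conditions on the values `a j`, `b j` under which a function that takes either of them on
each dyadic cell whose indices add up to `j` is nondecreasing with values in `[0,1]`, whatever the
choices; `M` bounds the sums of indices that occur. -/
structure IsStaircase (M : ℕ) (a b : ℕ → ℝ) : Prop where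
  nonneg : ∀ j, 0 ≤ a j
  le : ∀ j, a j ≤ b j
  le_succ : ∀ j, b j ≤ a (j + 1)
  le_one : ∀ j ≤ M, b j ≤ 1

lemma isStaircase_div {M : ℕ} {D : ℝ} (hMD : M + 1 ≤ D) :
    IsStaircase M (fun j => j / D) fun j => (j + 1) / D where
  nonneg j := by
    have : 0 ≤ D := by linarith [M.cast_nonneg (α := ℝ)]
    positivity
  le j := by
    have : 0 ≤ D := by linarith [M.cast_nonneg (α := ℝ)]
    gcongr
    exact le_add_of_nonneg_right zero_le_one
  le_succ j := by rw [Nat.cast_add_one]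
  le_one j hj := by
    have hj : (j : ℝ) ≤ M := Nat.cast_le.2 hj
    exact div_le_one_of_le₀ (by linarith) (by linarith [M.cast_nonneg (α := ℝ)])

lemma isStaircase_ite (M N : ℕ) :
    IsStaircase M (fun j => if N < j then 1 else 0) fun j => if N ≤ j then 1 else 0 where
  nonneg j := by split_ifs <;> norm_num
  le j := by split_ifs <;> first | omega | norm_num
  le_succ j := by split_ifs <;> first | omega | norm_num
  le_one j _ := by split_ifs <;> norm_num

open Classical in
/-- The step function for the staircase `a`, `b` that takes the upper value `b` on the dyadic cells
of level `k` in `s` and the lower value `a` on the others. -/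
noncomputable def stepFunction {d : ℕ} (k : ℕ) (a b : ℕ → ℝ) (s : Finset (Fin d → ℕ))
    (x : UnitCube d) : ℝ :=
  if cellIndex k x ∈ s then b (∑ i, cellIndex k x i) else a (∑ i, cellIndex k x i)

section StepFunction

variable {d k : ℕ} {a b : ℕ → ℝ}

lemma IsStaircase.stepFunction_mem_Icc {M : ℕ} (h : IsStaircase M a b) (s : Finset (Fin d → ℕ))
    (x : UnitCube d) : stepFunction k a b s x ∈
      Set.Icc (a (∑ i, cellIndex k x i)) (b (∑ i, cellIndex k x i)) := by
  unfold stepFunction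
  split_ifs
  · exact ⟨h.le _, le_rfl⟩
  · exact ⟨le_rfl, h.le _⟩

lemma IsStaircase.monotone_stepFunction {M : ℕ} (h : IsStaircase M a b)
    (s : Finset (Fin d → ℕ)) : Monotone (stepFunction k a b s) := by
  intro x y hxy
  have hindex : cellIndex k x ≤ cellIndex k y := fun i => dyadicIndex_mono k (hxy i)
  have ha : Monotone a := monotone_nat_of_le_succ fun j => (h.le j).trans (h.le_succ j)
  rcases hindex.eq_or_lt with heq | hlt
  · exact (by rw [stepFunction, stepFunction, heq] :
      stepFunction k a b s x = stepFunction k a b s y).le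
  · have hsum : ∑ i, cellIndex k x i < ∑ i, cellIndex k y i := Fintype.sum_strictMono hlt
    calc stepFunction k a b s x ≤ b (∑ i, cellIndex k x i) := (h.stepFunction_mem_Icc s x).2
      _ ≤ a (∑ i, cellIndex k x i + 1) := h.le_succ _
      _ ≤ a (∑ i, cellIndex k y i) := ha hsum
      _ ≤ stepFunction k a b s y := (h.stepFunction_mem_Icc s y).1

lemma IsStaircase.stepFunction_mem_monotoneClass (h : IsStaircase (d * 2 ^ k) a b)
    (s : Finset (Fin d → ℕ)) : stepFunction k a b s ∈ monotoneClass d := by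
  have hsum (x : UnitCube d) : ∑ i, cellIndex k x i ≤ d * 2 ^ k := by
    simpa using Finset.sum_le_card_nsmul Finset.univ (cellIndex k x) (2 ^ k)
      fun i _ => (dyadicIndex_lt k (x i)).le
  have hIcc := h.stepFunction_mem_Icc (k := k) s
  exact ⟨fun x => ⟨(h.nonneg _).trans (hIcc x).1, (hIcc x).2.trans (h.le_one _ (hsum x))⟩,
    fun x i => Or.inl fun u v huv =>
      h.monotone_stepFunction s (Function.update_mono (f := x) (i := i) huv)⟩

lemma measurable_stepFunction (k : ℕ) (a b : ℕ → ℝ) (s : Finset (Fin d → ℕ)) :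
    Measurable (stepFunction k a b s) := by
  classical
  exact (Measurable.of_discrete (f := fun c : Fin d → ℕ =>
    if c ∈ s then b (∑ i, c i) else a (∑ i, c i))).comp (measurable_cellIndex k)

lemma le_abs_stepFunction_sub {h : ℝ} {s s' : Finset (Fin d → ℕ)} {x : UnitCube d}
    (hx : cellIndex k x ∈ symmDiff s s')
    (hgap : a (∑ i, cellIndex k x i) + h ≤ b (∑ i, cellIndex k x i)) :
    h ≤ |stepFunction k a b s x - stepFunction k a b s' x| := by
  rcases Finset.mem_symmDiff.1 hx with hx | hx
  · rw [stepFunction, stepFunction, if_pos hx.1, if_neg hx.2]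
    exact le_abs.2 (Or.inl (by linarith))
  · rw [stepFunction, stepFunction, if_neg hx.2, if_pos hx.1]
    exact le_abs.2 (Or.inr (by linarith))

lemma le_eLpNorm_stepFunction_sub_rpow {h p : ℝ} (hp : 0 < p) (hh : 0 ≤ h)
    {s s' : Finset (Fin d → ℕ)} (hcells : symmDiff s s' ⊆ cells d k)
    (hgap : ∀ c ∈ symmDiff s s', a (∑ i, c i) + h ≤ b (∑ i, c i)) :
    ENNReal.ofReal (h ^ p * ((symmDiff s s').card * (2 ^ k)⁻¹ ^ d)) ≤
      eLpNorm (stepFunction k a b s - stepFunction k a b s') (ENNReal.ofReal p) volume ^ p := by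
  have hmeas : AEStronglyMeasurable (stepFunction k a b s - stepFunction k a b s') volume :=
    ((measurable_stepFunction k a b s).sub (measurable_stepFunction k a b s')).aestronglyMeasurable
  have hmarkov := mul_meas_ge_le_pow_eLpNorm (p := ENNReal.ofReal p) volume (by simpa using hp)
    ENNReal.ofReal_ne_top hmeas (ENNReal.ofReal (h ^ p))
  rw [ENNReal.toReal_ofReal hp.le] at hmarkov
  refine le_trans ?_ hmarkov
  rw [ENNReal.ofReal_mul (by positivity), ← volume_cellIndex_mem hcells]
  refine mul_le_mul_right (measure_mono fun x hx => ?_) _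
  rw [Set.mem_ofPred_eq, Pi.sub_apply, Real.enorm_eq_ofReal_abs,
    ENNReal.ofReal_rpow_of_nonneg (abs_nonneg _) hp.le]
  exact ENNReal.ofReal_le_ofReal
    (Real.rpow_le_rpow hh (le_abs_stepFunction_sub hx (hgap _ hx)) hp.le)

end StepFunction

section Hamming

variable {α : Type*} {S : Finset α} {G : Finset (Finset α)}

lemma card_le_of_forall_eight_mul_card_le (hG : ∀ s ∈ G, s ⊆ S)
    (hcard : ∀ s ∈ G, 8 * s.card ≤ S.card) : (G.card : ℝ) ≤ (3 / 2) ^ S.card := by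
  -- Chernoff's bound: the weight `(6/5) ^ |S| * (5/6) ^ (8 * |s|)` is at least `1` on `G`.
  have hweight : ∀ s ∈ G, (1 : ℝ) ≤ (6 / 5) ^ S.card * ((5 / 6) ^ 8) ^ s.card := fun s hs => by
    rw [← pow_mul, ← inv_div, inv_pow, ← div_eq_inv_mul, one_le_div (by positivity)]
    exact pow_le_pow_of_le_one (by norm_num) (by norm_num) (hcard s hs)
  calc (G.card : ℝ) = ∑ _s ∈ G, (1 : ℝ) := by simp
    _ ≤ ∑ s ∈ G, (6 / 5 : ℝ) ^ S.card * ((5 / 6) ^ 8) ^ s.card := Finset.sum_le_sum hweight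
    _ ≤ ∑ s ∈ S.powerset, (6 / 5 : ℝ) ^ S.card * ((5 / 6) ^ 8) ^ s.card :=
        Finset.sum_le_sum_of_subset_of_nonneg (fun s hs => Finset.mem_powerset.2 (hG s hs))
          fun _ _ _ => by positivity
    _ = (6 / 5 * ((5 / 6) ^ 8 + 1)) ^ S.card := by
        rw [← Finset.mul_sum, mul_pow, ← Finset.sum_pow_mul_eq_add_pow]
        simp
    _ ≤ (3 / 2) ^ S.card := by
        gcongr
        norm_num

lemma card_le_of_forall_eight_mul_card_symmDiff_le [DecidableEq α] (hG : ∀ s ∈ G, s ⊆ S)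
    (hdist : ∀ s ∈ G, ∀ s' ∈ G, 8 * (symmDiff s s').card ≤ S.card) :
    (G.card : ℝ) ≤ (3 / 2) ^ S.card := by
  rcases G.eq_empty_or_nonempty with rfl | ⟨s₀, hs₀⟩
  · rw [Finset.card_empty, Nat.cast_zero]
    positivity
  · rw [← Finset.card_image_of_injective G (symmDiff_left_injective s₀)]
    refine card_le_of_forall_eight_mul_card_le ?_ ?_ <;> rw [Finset.forall_mem_image]
    · intro s hs c hc
      exact (Finset.mem_symmDiff.1 hc).elim (fun h => hG s hs h.1) fun h => hG s₀ hs₀ h.1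
    · exact fun s hs => hdist s hs s₀ hs₀

end Hamming

lemma eight_mul_card_symmDiff_le {d k : ℕ} {a b : ℕ → ℝ} {h p ε : ℝ} (hp : 0 < p) (hh : 0 < h)
    (hε : 0 ≤ ε) {S s s' : Finset (Fin d → ℕ)} (hS : S ⊆ cells d k)
    (hgap : ∀ c ∈ S, a (∑ i, c i) + h ≤ b (∑ i, c i))
    (hSε : (2 * ε) ^ p ≤ h ^ p * (S.card / 8 * (2 ^ k)⁻¹ ^ d)) (hs : s ⊆ S) (hs' : s' ⊆ S)
    (hclose : eLpNorm (stepFunction k a b s - stepFunction k a b s') (ENNReal.ofReal p) volume ≤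
      ENNReal.ofReal (2 * ε)) : 8 * (symmDiff s s').card ≤ S.card := by
  have hsymmDiff : symmDiff s s' ⊆ S := fun c hc =>
    (Finset.mem_symmDiff.1 hc).elim (fun h => hs h.1) fun h => hs' h.1
  have hmass : h ^ p * ((symmDiff s s').card * (2 ^ k)⁻¹ ^ d) ≤ (2 * ε) ^ p := by
    rw [← ENNReal.ofReal_le_ofReal_iff (by positivity),
      ← ENNReal.ofReal_rpow_of_nonneg (by positivity) hp.le]
    exact (le_eLpNorm_stepFunction_sub_rpow hp hh.le (hsymmDiff.trans hS)
      fun c hc => hgap c (hsymmDiff hc)).trans (ENNReal.rpow_le_rpow hclose hp.le)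
  have hcard : ((symmDiff s s').card : ℝ) ≤ S.card / 8 :=
    le_of_mul_le_mul_right (le_of_mul_le_mul_left (hmass.trans hSε) (by positivity))
      (by positivity)
  rw [le_div_iff₀' (by norm_num)] at hcard
  exact_mod_cast hcard

lemma IsStaircase.card_div_four_le_lpEntropy {d k : ℕ} {a b : ℕ → ℝ}
    (hab : IsStaircase (d * 2 ^ k) a b) {h p ε : ℝ} (hp : 1 ≤ p) (hh : 0 < h) (hε : 0 ≤ ε)
    {S : Finset (Fin d → ℕ)} (hS : S ⊆ cells d k)
    (hgap : ∀ c ∈ S, a (∑ i, c i) + h ≤ b (∑ i, c i))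
    (hSε : (2 * ε) ^ p ≤ h ^ p * (S.card / 8 * (2 ^ k)⁻¹ ^ d)) :
    ((S.card / 4 : ℝ) : EReal) ≤ lpEntropy (monotoneClass d) p ε := by
  refine le_lpEntropy fun m hm => ?_
  have hpacking : (S.powerset.card : ℝ) ≤ m * (3 / 2) ^ S.card :=
    hm.card_le_mul hp hε (φ := stepFunction k a b) hab.stepFunction_mem_monotoneClass
      (fun s => (measurable_stepFunction k a b s).aestronglyMeasurable) fun U hU hclose =>
        card_le_of_forall_eight_mul_card_symmDiff_le (fun s hs => Finset.mem_powerset.1 (hU hs))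
          fun s hs s' hs' => eight_mul_card_symmDiff_le (zero_lt_one.trans_le hp) hh hε hS hgap hSε
            (Finset.mem_powerset.1 (hU hs)) (Finset.mem_powerset.1 (hU hs')) (hclose s hs s' hs')
  have hexp : Real.exp (1 / 4) ≤ 4 / 3 := by
    convert (Real.exp_bound_div_one_sub_of_interval (x := 1 / 4) (by norm_num) (by norm_num))
      using 1
    norm_num
  calc Real.exp (S.card / 4) = Real.exp (1 / 4) ^ S.card := by
        rw [← Real.exp_nat_mul, mul_one_div]
    _ ≤ (4 / 3) ^ S.card := by gcongr
    _ = 2 ^ S.card / (3 / 2) ^ S.card := by rw [← div_pow]; norm_num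
    _ ≤ m := by
        rw [div_le_iff₀ (by positivity)]
        simpa using hpacking

lemma log_two_le_lpEntropy {d : ℕ} {p ε : ℝ} (hp : 1 ≤ p) (hε : 0 ≤ ε) (hε' : ε < 1 / 2) :
    (Real.log 2 : EReal) ≤ lpEntropy (monotoneClass d) p ε := by
  refine le_lpEntropy fun m hm => ?_
  have hp0 : ENNReal.ofReal p ≠ 0 := by simpa using zero_lt_one.trans_le hp
  have hpacking : ((Finset.univ : Finset Bool).card : ℝ) ≤ m * 1 := by
    refine hm.card_le_mul hp hε (φ := fun i _ => if i then 1 else 0)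
      (fun i => ⟨fun _ => by split_ifs <;> norm_num, fun _ _ => Or.inl monotone_const⟩)
      (fun i => aestronglyMeasurable_const) fun U _ hclose => ?_
    rw [Nat.cast_le_one, Finset.card_le_one]
    intro i hi j hj
    have hnorm := hclose i hi j hj
    by_contra hij
    have hdist : eLpNorm ((fun _ : UnitCube d => if i then (1 : ℝ) else 0) -
        fun _ => if j then 1 else 0) (ENNReal.ofReal p) volume = 1 := by
      change eLpNorm (fun _ : UnitCube d => (if i then (1 : ℝ) else 0) - if j then 1 else 0) _ _ = 1
      rw [eLpNorm_const _ hp0 (NeZero.ne _)]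
      cases i <;> cases j <;> simp_all
    rw [hdist, ENNReal.one_le_ofReal] at hnorm
    linarith
  rw [Real.exp_log two_pos]
  simpa using hpacking

lemma pow_div_four_le_lpEntropy {d k : ℕ} (hd : 1 ≤ d) {p ε : ℝ} (hp : 1 ≤ p) (hε : 0 ≤ ε)
    (hk : 32 * d * (2 : ℝ) ^ k * ε ≤ 1) :
    ((((2 : ℝ) ^ k) ^ d / 4 : ℝ) : EReal) ≤ lpEntropy (monotoneClass d) p ε := by
  have hd0 : (1 : ℝ) ≤ d := Nat.one_le_cast.2 hd
  have hk1 : (1 : ℝ) ≤ 2 ^ k := one_le_pow₀ one_le_two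
  have hstaircase : IsStaircase (d * 2 ^ k) (fun j => (j : ℝ) / (2 * d * 2 ^ k))
      fun j => (j + 1) / (2 * d * 2 ^ k) := isStaircase_div <| by
    push_cast
    linarith [one_le_mul_of_one_le_of_one_le hd0 hk1]
  have hsmall : (2 * ε) ^ p ≤
      (1 / (2 * d * 2 ^ k)) ^ p * ((cells d k).card / 8 * (2 ^ k)⁻¹ ^ d) :=
    calc (2 * ε) ^ p ≤ (1 / (2 * d * 2 ^ k) * (1 / 8)) ^ p := by
          refine Real.rpow_le_rpow (by positivity) ?_ (by linarith)
          rw [div_mul_div_comm, le_div_iff₀ (by positivity)]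
          linarith
      _ = (1 / (2 * d * 2 ^ k)) ^ p * (1 / 8) ^ p := Real.mul_rpow (by positivity) (by norm_num)
      _ ≤ (1 / (2 * d * 2 ^ k)) ^ p * (1 / 8) := by
          gcongr
          exact Real.rpow_le_self_of_le_one (by norm_num) (by norm_num) hp
      _ = (1 / (2 * d * 2 ^ k)) ^ p * ((cells d k).card / 8 * (2 ^ k)⁻¹ ^ d) := by
          rw [card_cells, inv_pow]
          push_cast
          field_simp
  have hbound := hstaircase.card_div_four_le_lpEntropy hp (by positivity) hε subset_rfl
    (fun c _ => (add_div _ _ _).ge) hsmall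
  rwa [card_cells, Nat.cast_pow, Nat.cast_pow, Nat.cast_two] at hbound

lemma exists_le_card_filter_sum_eq {d : ℕ} (hd : 1 ≤ d) (k : ℕ) : ∃ N : ℕ,
    ((2 : ℝ) ^ k) ^ (d - 1) / d ≤ ((cells d k).filter fun c => ∑ i, c i = N).card := by
  have hmaps : ∀ c ∈ cells d k, ∑ i, c i ∈ Finset.range (d * 2 ^ k) := fun c hc => by
    have : Nonempty (Fin d) := ⟨⟨0, hd⟩⟩
    simpa using Finset.sum_lt_sum_of_nonempty Finset.univ_nonempty fun i _ => mem_cells.1 hc i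
  have hpow : ((2 : ℝ) ^ k) ^ d = (2 ^ k) ^ (d - 1) * 2 ^ k := (pow_sub_one_mul (by omega) _).symm
  obtain ⟨N, -, hcard⟩ := Finset.exists_le_card_fiber_of_nsmul_le_card_of_maps_to
    (b := ((2 : ℝ) ^ k) ^ (d - 1) / d) hmaps (Finset.nonempty_range_iff.2 (by positivity)) <| by
      rw [Finset.card_range, card_cells, nsmul_eq_mul]
      push_cast
      rw [hpow]
      apply le_of_eq
      field_simp
  exact ⟨N, hcard⟩

lemma pow_pred_div_le_lpEntropy {d k : ℕ} (hd : 1 ≤ d) {p ε : ℝ} (hp : 1 ≤ p) (hε : 0 ≤ ε)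
    (hk : 8 * d * (2 : ℝ) ^ k * (2 * ε) ^ p ≤ 1) :
    ((((2 : ℝ) ^ k) ^ (d - 1) / (4 * d) : ℝ) : EReal) ≤ lpEntropy (monotoneClass d) p ε := by
  have : (0 : ℝ) < d := Nat.cast_pos.2 hd
  have hpow : ((2 : ℝ) ^ k) ^ d = (2 ^ k) ^ (d - 1) * 2 ^ k := (pow_sub_one_mul (by omega) _).symm
  obtain ⟨N, hcard⟩ := exists_le_card_filter_sum_eq hd k
  set S := (cells d k).filter fun c => ∑ i, c i = N
  have hgap : ∀ c ∈ S, (if N < ∑ i, c i then (1 : ℝ) else 0) + 1 ≤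
      if N ≤ ∑ i, c i then 1 else 0 := fun c hc => by simp [(Finset.mem_filter.1 hc).2]
  have hsmall : (2 * ε) ^ p ≤ 1 ^ p * (S.card / 8 * (2 ^ k)⁻¹ ^ d) :=
    calc (2 * ε) ^ p ≤ 1 / (8 * d * 2 ^ k) := (le_div_iff₀' (by positivity)).2 hk
      _ = 1 ^ p * ((2 ^ k) ^ (d - 1) / d / 8 * (2 ^ k)⁻¹ ^ d) := by
          rw [inv_pow, hpow, Real.one_rpow]
          field_simp
      _ ≤ 1 ^ p * (S.card / 8 * (2 ^ k)⁻¹ ^ d) := by gcongr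
  refine le_trans ?_ ((isStaircase_ite _ N).card_div_four_le_lpEntropy hp one_pos hε
    (Finset.filter_subset _ _) hgap hsmall)
  rw [EReal.coe_le_coe_iff, mul_comm, ← div_div]
  gcongr

lemma exists_lpEntropy_ge_of_pow {d : ℕ} {p A B a : ℝ} (hp : 1 ≤ p) (hA : 0 < A) (hB : 0 < B)
    (b : ℕ) (H : ∀ (ε : ℝ) (k : ℕ), 0 < ε → A * (2 : ℝ) ^ k * ε ^ a ≤ 1 →
      ((B * ((2 : ℝ) ^ k) ^ b : ℝ) : EReal) ≤ lpEntropy (monotoneClass d) p ε) :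
    ∃ c : ℝ, 0 < c ∧ ∀ ε : ℝ, 0 < ε → ε < 1 / 2 →
      ((c * ε ^ (-(b * a)) : ℝ) : EReal) ≤ lpEntropy (monotoneClass d) p ε := by
  have : 0 < Real.log 2 := Real.log_pos one_lt_two
  refine ⟨min (B / (2 * A) ^ b) (Real.log 2 / A ^ b), by positivity, fun ε hε hε' => ?_⟩
  have hpow : ε ^ (-(b * a)) = (ε ^ (-a)) ^ b := by
    rw [← Real.rpow_mul_natCast hε.le, neg_mul, mul_comm]
  rw [hpow]
  rcases lt_or_ge (ε ^ (-a)) A with hεA | hεA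
  · refine le_trans (EReal.coe_le_coe_iff.2 ?_) (log_two_le_lpEntropy hp hε.le hε')
    calc _ ≤ Real.log 2 / A ^ b * A ^ b := by
          gcongr
          exact min_le_right _ _
      _ = Real.log 2 := div_mul_cancel₀ _ (by positivity)
  · obtain ⟨k, hk, hk'⟩ := exists_nat_pow_near ((one_le_div hA).2 hεA) (one_lt_two (α := ℝ))
    rw [le_div_iff₀' hA] at hk
    rw [div_lt_iff₀ hA, pow_succ, mul_assoc] at hk'
    refine le_trans (EReal.coe_le_coe_iff.2 ?_) (H ε k hε ?_)
    · calc _ ≤ B / (2 * A) ^ b * (2 ^ k * (2 * A)) ^ b := by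
            gcongr
            exact min_le_left _ _
        _ = B * (2 ^ k) ^ b := by
            rw [mul_pow (2 ^ k : ℝ)]
            field_simp
    · calc A * 2 ^ k * ε ^ a ≤ ε ^ (-a) * ε ^ a := by gcongr
        _ = 1 := by rw [← Real.rpow_add hε, neg_add_cancel, Real.rpow_zero]

lemma exists_lpEntropy_ge_dim {d : ℕ} (hd : 1 ≤ d) {p : ℝ} (hp : 1 ≤ p) :
    ∃ c : ℝ, 0 < c ∧ ∀ ε : ℝ, 0 < ε → ε < 1 / 2 →
      ((c * ε ^ (-(d : ℝ)) : ℝ) : EReal) ≤ lpEntropy (monotoneClass d) p ε := by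
  simpa only [mul_one] using exists_lpEntropy_ge_of_pow (A := 32 * d) (B := 1 / 4) (a := 1) hp
    (by positivity) (by norm_num) d fun ε k hε hk => by
      rw [Real.rpow_one] at hk
      rw [one_div_mul_eq_div]
      exact pow_div_four_le_lpEntropy hd hp hε.le hk

lemma exists_lpEntropy_ge_dim_sub_one_mul {d : ℕ} (hd : 1 ≤ d) {p : ℝ} (hp : 1 ≤ p) :
    ∃ c : ℝ, 0 < c ∧ ∀ ε : ℝ, 0 < ε → ε < 1 / 2 →
      ((c * ε ^ (-(((d : ℝ) - 1) * p)) : ℝ) : EReal) ≤ lpEntropy (monotoneClass d) p ε := by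
  rw [← Nat.cast_pred hd]
  refine exists_lpEntropy_ge_of_pow (A := 8 * d * 2 ^ p) (B := 1 / (4 * d)) hp (by positivity)
    (by positivity) (d - 1) fun ε k hε hk => ?_
  rw [one_div_mul_eq_div]
  refine pow_pred_div_le_lpEntropy hd hp hε.le (le_of_eq_of_le ?_ hk)
  rw [Real.mul_rpow two_pos.le hε.le]
  ring

lemma exists_lpEntropy_ge_max {d : ℕ} (hd : 1 ≤ d) {p : ℝ} (hp : 1 ≤ p) :
    ∃ c : ℝ, 0 < c ∧ ∀ ε : ℝ, 0 < ε → ε < 1 / 2 →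
      ((c * ε ^ (-(max (d : ℝ) (((d : ℝ) - 1) * p))) : ℝ) : EReal) ≤
        lpEntropy (monotoneClass d) p ε := by
  rcases le_total (((d : ℝ) - 1) * p) d with h | h
  · rw [max_eq_left h]
    exact exists_lpEntropy_ge_dim hd hp
  · rw [max_eq_right h]
    exact exists_lpEntropy_ge_dim_sub_one_mul hd hp

theorem theorem1p1 (d : ℕ) (hd : 1 ≤ d) (p : ℝ) (hp : 1 ≤ p) :
    ∃ c₁ c₂ : ℝ, 0 < c₁ ∧ 0 < c₂ ∧
      (((d : ℝ) - 1) * p ≠ d →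
        ∀ ε : ℝ, 0 < ε → ε < 1 / 2 →
          ((c₁ * ε ^ (-(max (d : ℝ) (((d : ℝ) - 1) * p))) : ℝ) : EReal)
              ≤ lpEntropy (monotoneClass d) p ε ∧
          lpEntropy (monotoneClass d) p ε ≤ lpBracketingEntropy (monotoneClass d) p ε ∧
          lpBracketingEntropy (monotoneClass d) p ε
              ≤ ((c₂ * ε ^ (-(max (d : ℝ) (((d : ℝ) - 1) * p))) : ℝ) : EReal)) ∧
      (((d : ℝ) - 1) * p = d →
        ∀ ε : ℝ, 0 < ε → ε < 1 / 2 →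
          ((c₁ * ε ^ (-(d : ℝ)) : ℝ) : EReal) ≤ lpEntropy (monotoneClass d) p ε ∧
          lpEntropy (monotoneClass d) p ε ≤ lpBracketingEntropy (monotoneClass d) p ε ∧
          lpBracketingEntropy (monotoneClass d) p ε
              ≤ ((c₂ * ε ^ (-(d : ℝ)) * (Real.log (1 / ε)) ^ (1 + (d : ℝ) / p) : ℝ) : EReal)) := by
  by_cases hpd : ((d : ℝ) - 1) * p = d
  · obtain ⟨c₁, hc₁, hlower⟩ := exists_lpEntropy_ge_dim hd hp
    obtain ⟨c₂, hc₂, hupper⟩ :=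
      exists_lpBracketingEntropy_le_critical hd (zero_lt_one.trans_le hp) hpd
    exact ⟨c₁, c₂, hc₁, hc₂, fun h => absurd hpd h, fun _ ε hε hε' =>
      ⟨hlower ε hε hε', lpEntropy_le_lpBracketingEntropy _ _ _, hupper ε hε hε'⟩⟩
  · obtain ⟨c₁, hc₁, hlower⟩ := exists_lpEntropy_ge_max hd hp
    obtain ⟨c₂, hc₂, hupper⟩ := exists_lpBracketingEntropy_le hd hp hpd
    exact ⟨c₁, c₂, hc₁, hc₂, fun _ ε hε hε' =>
      ⟨hlower ε hε hε', lpEntropy_le_lpBracketingEntropy _ _ _, hupper ε hε hε'⟩,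
      fun h => absurd h hpd⟩
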